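/- **Model.** A distributed system has a finite set $\Pi$ of asynchronous processors and one FIFO channel from every processor to every processor, including itself. Every processor and every message has a classical part and a quantum part; the finite-dimensional Hilbert space of the quantum part is determined by the classical state. A state of the system consists of the classical states of all processors, the sequences of messages in all channels, and a (subnormalized) density matrix on the tensor product of all Hilbert spaces. An *operation* on a component selects, from the classical state $\sigma$ of the component, completely positive maps $\Lambda^r[\sigma]$ (for the finitely many outcomes $r$) whose sum is trace preserving, and new classical states $\kappa(\sigma,r)$. An *event* occurs at a processor and is an invocation, a response, the application of an operation with a given outcome $r$ (the quantum state becomes $(\Lambda^r\otimes\mathrm{id})(\rho)$), the sending of a message (its quantum part is a tensor factor split off from that of the sender), or the reception of the first message of a channel. A *distributed algorithm* $\mathcal A$ consists of a set of initial states and, for each processor $\pi$, a predicate saying which events may take $\pi$ from one classical state to another; it depends only on the classical state of $\pi$ and the classical part of the message sent or received. A finite *execution* is an initial state with a finite sequence of events, each of them permitted in the state reached before it. The *causal precedence relation* of an execution is the transitive closure of the relation that orders consecutive events at the same processor, and the sending of a message before the reception of the same message. Two executions are *equicausal* if they have the same initial state, the same set of events (possibly in different orders) and the same causal precedence relation. **Global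 operations and atomic specification.** A *decomposable global operation* $G$ consists of an operation $G_\pi$ for each processor $\pi$ and an operation $G_\mu$ for each message $\mu$. The *atomic specification* $\hat\delta$ of $\mathcal A$ adds to each processor $\pi$ a register that holds $\bot$ or a pair (global operation, response or $\bot$), initially $\bot$. Its events are: the events of $\mathcal A$; the invocation of $G$ at a processor whose register is $\bot$, which sets the register to $(G,\bot)$; if some register is $(G,\bot)$, the atomic execution of $G$, which at one instant applies $G_\pi$ to every processor and $G_\mu$ to every message in flight and sets the register of every processor $\pi$ to $(G,R_\pi)$, where $R_\pi$ lists the outcome on $\pi$ and, for each channel into $\pi$, the outcomes on the messages in that channel, in order; and the response $R_\pi$ of a processor with register $(G,R_\pi)$, which resets the register to $\bot$. **QGO algorithm.** The algorithm $\tilde{\mathcal A}$ runs $\mathcal A$, starting from an initial state of $\mathcal A$ with no global operation underway and no markers in the channels, and has in addition the following procedures, each consisting of several events between which no other event occurs at the same processor. When $G$ is invoked at $\pi$, or when $\pi$, not taking part in a global operation, receives a marker $G$, it applies $G_\pi$ to itself and records the outcome, opens an empty record for each incoming channel, starts to wait for all incoming channels (except the one on which the marker came, if any), and sends a marker $G$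 on each outgoing channel (including the one to itself). When a participating processor receives a marker, it stops waiting for that channel, and if it then waits for no channel, it responds with its record and stops participating. When a processor receives a message of $\mathcal A$ from a channel it is waiting for, it applies $G_\mu$ to the message, appends the outcome to the record of the channel, and then passes the message on to $\mathcal A$; all other messages of $\mathcal A$ are passed on to $\mathcal A$ directly upon reception. **Histories.** The *history* $\mathscr H(X)$ of an execution $X$ of $\tilde{\mathcal A}$ or of $\hat\delta$ is the sequence of those of its events that are invocations, responses, or events of the base algorithm $\mathcal A$ (the reception of a message by $\mathcal A$ being the event at which the message is passed on to $\mathcal A$). For executions $Y$ of $\tilde{\mathcal A}$ and $\hat Y$ of $\hat\delta$ write $\mathscr H(Y)\simeq\mathscr H(\hat Y)$ if the two histories have the same length and, for every $i$, their $i$-th events are invocations of the same global operation at the same processor, or the same response given to a global operation at the same processor, or correspond to the same step of $\mathcal A$ at the same processor. **Theorem.** Let $\tilde X$ be a finite execution of $\tilde{\mathcal A}$ without pending global operations (to each invocation of a global operation all processors have responded) and without concurrent ones (every invocation of a global operation happens after all processors have responded to the previous one). Then there are an execution $\tilde Y$ of $\tilde{\mathcal A}$ and an execution $\hat Y$ of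 the atomic specification $\hat\delta$ of $\mathcal A$, starting from the same initial state of $\mathcal A$, such that $\tilde X$ and $\tilde Y$ are equicausal and $\mathscr H(\tilde Y)\simeq\mathscr H(\hat Y)$. -/

import Mathlib

universe u

open scoped ComplexOrder

noncomputable section

namespace QDist

/-! ## Quantum operations

A finite-dimensional Hilbert space is given by the finite set `n` indexing its standard basis, and
operators on it are matrices `Matrix n n ℂ`. -/

/-- `Λ ⊗ id` on `ℂ^n ⊗ ℂ^k`. -/
def tensorId {n m : Type} (k : Type) (Λ : Matrix n n ℂ →ₗ[ℂ] Matrix m m ℂ) :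
    Matrix (n × k) (n × k) ℂ →ₗ[ℂ] Matrix (m × k) (m × k) ℂ where
  toFun ρ := fun x y => Λ (fun i j => ρ (i, x.2) (j, y.2)) x.1 y.1
  map_add' ρ ρ' := by
    ext x y
    exact congrFun (congrFun (map_add Λ (fun i j => ρ (i, x.2) (j, y.2))
      (fun i j => ρ' (i, x.2) (j, y.2))) x.1) y.1
  map_smul' c ρ := by
    ext x y
    exact congrFun (congrFun (map_smul Λ c (fun i j => ρ (i, x.2) (j, y.2))) x.1) y.1

/-- `id ⊗ Λ` on `ℂ^k ⊗ ℂ^n`. -/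
def idTensor {n m : Type} (k : Type) (Λ : Matrix n n ℂ →ₗ[ℂ] Matrix m m ℂ) :
    Matrix (k × n) (k × n) ℂ →ₗ[ℂ] Matrix (k × m) (k × m) ℂ where
  toFun ρ := fun x y => Λ (fun i j => ρ (x.1, i) (y.1, j)) x.2 y.2
  map_add' ρ ρ' := by
    ext x y
    exact congrFun (congrFun (map_add Λ (fun i j => ρ (x.1, i) (y.1, j))
      (fun i j => ρ' (x.1, i) (y.1, j))) x.2) y.2
  map_smul' c ρ := by
    ext x y
    exact congrFun (congrFun (map_smul Λ c (fun i j => ρ (x.1, i) (y.1, j))) x.2) y.2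

/-- Complete positivity: `Λ ⊗ id` preserves positive semidefiniteness, for every ancilla. -/
def CompletelyPositive {n m : Type} (Λ : Matrix n n ℂ →ₗ[ℂ] Matrix m m ℂ) : Prop :=
  ∀ (k : Type) [Finite k] (ρ : Matrix (n × k) (n × k) ℂ),
    ρ.PosSemidef → (tensorId k Λ ρ).PosSemidef

theorem CompletelyPositive.tensorId {n m : Type} {Λ : Matrix n n ℂ →ₗ[ℂ] Matrix m m ℂ}
    (h : CompletelyPositive Λ) (k : Type) [Finite k] : CompletelyPositive (tensorId k Λ) := by
  intro l _ ρ hρ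
  exact (h (k × l) (ρ.submatrix (Equiv.prodAssoc n k l).symm (Equiv.prodAssoc n k l).symm)
    (hρ.submatrix _)).submatrix (Equiv.prodAssoc m k l)

theorem CompletelyPositive.idTensor {n m : Type} {Λ : Matrix n n ℂ →ₗ[ℂ] Matrix m m ℂ}
    (h : CompletelyPositive Λ) (k : Type) [Finite k] : CompletelyPositive (idTensor k Λ) := by
  intro l _ ρ hρ
  exact (h (k × l) (ρ.submatrix (fun x : n × (k × l) => ((x.2.1, x.1), x.2.2))
    (fun x : n × (k × l) => ((x.2.1, x.1), x.2.2)))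
    (hρ.submatrix _)).submatrix (fun x : (k × m) × l => (x.1.2, (x.1.1, x.2)))

theorem trace_tensorId {n m : Type} (k : Type) [Fintype n] [Fintype m] [Fintype k]
    (Λ : Matrix n n ℂ →ₗ[ℂ] Matrix m m ℂ) (ρ : Matrix (n × k) (n × k) ℂ) :
    (tensorId k Λ ρ).trace = ∑ c : k, (Λ (fun i j => ρ (i, c) (j, c))).trace := by
  simp only [Matrix.trace, Matrix.diag, Fintype.sum_prod_type_right]
  rfl

theorem trace_idTensor {n m : Type} (k : Type) [Fintype n] [Fintype m] [Fintype k]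
    (Λ : Matrix n n ℂ →ₗ[ℂ] Matrix m m ℂ) (ρ : Matrix (k × n) (k × n) ℂ) :
    (idTensor k Λ ρ).trace = ∑ c : k, (Λ (fun i j => ρ (c, i) (c, j))).trace := by
  simp only [Matrix.trace, Matrix.diag, Fintype.sum_prod_type]
  rfl

/-- An operation on a component at one of its classical states, with Hilbert space `ℂ^n`: a finite
set of possible outcomes, for each outcome `r` the new classical state `post r` and a linear map
into the operators on the new Hilbert space. The maps are completely positive and their sum is
trace preserving. `C` is the set of classical states of the component, and `H c` indexes the basis
of the Hilbert space of the component when its classical state is `c`. -/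
structure Instr {C : Type u} (H : C → Type) [∀ c, Fintype (H c)] (Out : Type u)
    (n : Type) [Fintype n] where
  outcomes : Finset Out
  post : Out → C
  map : ∀ r, Matrix n n ℂ →ₗ[ℂ] Matrix (H (post r)) (H (post r)) ℂ
  cp : ∀ r ∈ outcomes, CompletelyPositive (map r)
  tp : ∀ ρ : Matrix n n ℂ, ∑ r ∈ outcomes, (map r ρ).trace = ρ.trace

open Classical in
/-- The matrix elements `⟨x| Λ^r(|a⟩⟨b|) |y⟩`. -/
def Instr.ker {C : Type u} {H : C → Type} [∀ c, Fintype (H c)] {Out : Type u}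
    {n : Type} [Fintype n] (I : Instr H Out n) (r : Out)
    (x y : H (I.post r)) (a b : n) : ℂ :=
  I.map r (Matrix.single a b 1) x y

/-! ## Distributed systems and their states -/

/-- A distributed system. There is one FIFO channel from every processor to every processor
(including itself). `CState p` are the classical states of processor `p`, and `Msg` the classical
states of messages (a name of the message may be part of it). The classical state of a component
tells which Hilbert space its quantum part has: `HProc p σ`, `HMsg m` index the standard basis.
`Out` are the outcomes of operations, `Inv` and `Res` the invocations and responses exchanged with
the outside world. -/
structure DistSys where
  Proc : Type u
  [procFintype : Fintype Proc]
  [procDecEq : DecidableEq Proc]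
  CState : Proc → Type u
  Msg : Type u
  HProc : ∀ p, CState p → Type
  HMsg : Msg → Type
  [hprocFintype : ∀ p σ, Fintype (HProc p σ)]
  [hmsgFintype : ∀ m, Fintype (HMsg m)]
  Out : Type u
  Inv : Type u
  Res : Type u

attribute [instance] DistSys.procFintype DistSys.procDecEq DistSys.hprocFintype
  DistSys.hmsgFintype

variable (S : DistSys.{u})

/-- Classical state of the whole system; `chan (p, q)` is the content of the channel from `p` to
`q`, the oldest message first. -/
structure CConf where
  proc : ∀ p, S.CState p
  chan : S.Proc × S.Proc → List S.Msg

/-- Basis of the Hilbert space of a channel: the tensor product over its messages. -/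
def ChanIdx : List S.Msg → Type
  | [] => Unit
  | m :: l => S.HMsg m × ChanIdx l

instance chanIdxFintype : ∀ l : List S.Msg, Fintype (ChanIdx S l)
  | [] => inferInstanceAs (Fintype Unit)
  | m :: l =>
    haveI := chanIdxFintype l
    inferInstanceAs (Fintype (S.HMsg m × ChanIdx S l))

/-- Basis of the Hilbert space of the whole system: the tensor product over all processors and
channels. -/
abbrev Idx (c : CConf S) : Type u :=
  (∀ p, S.HProc p (c.proc p)) × (∀ χ, ChanIdx S (c.chan χ))

/-- State of the whole system: a classical state, and an operator on the joint Hilbert space. -/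
structure State where
  cl : CConf S
  ρ : Matrix (Idx S cl) (Idx S cl) ℂ

/-- The quantum part is a (subnormalized) density matrix. -/
def State.IsDensity {S : DistSys.{u}} (ψ : State S) : Prop :=
  ψ.ρ.PosSemidef ∧ ψ.ρ.trace.re ≤ 1

/-! ## Events -/

/-- A local step of processor `p`: what happens, together with the classical states `σ` and `σ'` of
`p` before and after. Bijections of bases express the mere relabelling of tensor factors.
* `invoke`, `respond`: an invocation arrives from, a response is given to the outside world;
* `apply σ I r`: an operation, which at `σ` is `I`, is applied to `p` with outcome `r`;
* `internal`: an operation without measurement, acting trivially on the quantum part;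
* `send q σ σ' m e`: the message `m` is sent to `q`, its quantum part being a tensor factor of the
  quantum part of `p`;
* `recv q σ σ' m e`: the message `m` from `q` is received, its quantum part becoming a tensor
  factor of the quantum part of `p`. -/
inductive LocalStep (p : S.Proc) : Type u
  | invoke (σ σ' : S.CState p) (i : S.Inv) (e : S.HProc p σ ≃ S.HProc p σ')
  | respond (σ σ' : S.CState p) (r : S.Res) (e : S.HProc p σ ≃ S.HProc p σ')
  | apply (σ : S.CState p) (I : Instr (S.HProc p) S.Out (S.HProc p σ)) (r : S.Out)
  | internal (σ σ' : S.CState p) (e : S.HProc p σ ≃ S.HProc p σ')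
  | send (q : S.Proc) (σ σ' : S.CState p) (m : S.Msg)
      (e : S.HProc p σ ≃ S.HProc p σ' × S.HMsg m)
  | recv (q : S.Proc) (σ σ' : S.CState p) (m : S.Msg)
      (e : S.HProc p σ × S.HMsg m ≃ S.HProc p σ')

/-- An event: a local step of the processor at which it occurs. -/
structure Event where
  proc : S.Proc
  step : LocalStep S proc

variable {S}

/-- The channel on which the event sends a message, if it does. -/
def Event.sentOn : Event S → Option (S.Proc × S.Proc)
  | ⟨p, .send q _ _ _ _⟩ => some (p, q)
  | _ => none

/-- The channel from which the event receives a message, if it does. -/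
def Event.recvOn : Event S → Option (S.Proc × S.Proc)
  | ⟨p, .recv q _ _ _ _⟩ => some (q, p)
  | _ => none

/-! ## The effect of an event on the state -/

section Update
variable {ι : Type u} [DecidableEq ι] {α : ι → Type u} {F : ∀ i, α i → Type}

/-- The basis label of component `i` after the state of `i` has been set to `v`. -/
def labelAt {s : ∀ i, α i} {i : ι} {v : α i} (x : ∀ j, F j (Function.update s i v j)) : F i v :=
  cast (by rw [Function.update_self]) (x i)

/-- From a family of labels after the state of `i` has been set to `v`, the family of labels before
that, with `a` as label of `i`. -/
def labelBack {s : ∀ i, α i} {i : ι} {v : α i} (x : ∀ j, F j (Function.update s i v j))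
    (a : F i (s i)) : ∀ j, F j (s j) :=
  fun j => if h : j = i then cast (by rw [h]) a
    else cast (by rw [Function.update_of_ne h]) (x j)

end Update

/-- Split off the label of the last message of a channel. -/
def ChanIdx.unsnoc (m : S.Msg) : ∀ l : List S.Msg, ChanIdx S (l ++ [m]) → ChanIdx S l × S.HMsg m
  | [], x => ((), x.1)
  | _ :: l, x => let y := ChanIdx.unsnoc m l x.2; ((x.1, y.1), y.2)

namespace State

/-- Processor `p` changes its classical state to `σ'`, the quantum state is only relabelled. -/
def relabel (ψ : State S) (p : S.Proc) (σ' : S.CState p)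
    (e : S.HProc p (ψ.cl.proc p) ≃ S.HProc p σ') : State S where
  cl := { proc := Function.update ψ.cl.proc p σ', chan := ψ.cl.chan }
  ρ := ψ.ρ.submatrix
    (fun x => (labelBack (F := S.HProc) x.1 (e.symm (labelAt (F := S.HProc) x.1)), x.2))
    (fun x => (labelBack (F := S.HProc) x.1 (e.symm (labelAt (F := S.HProc) x.1)), x.2))

/-- Processor `p` applies an operation to itself and obtains `r`: the quantum state becomes
`(Λ^r ⊗ id)(ρ)`. -/
def applyOp (ψ : State S) (p : S.Proc)
    (I : Instr (S.HProc p) S.Out (S.HProc p (ψ.cl.proc p))) (r : S.Out) : State S where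
  cl := { proc := Function.update ψ.cl.proc p (I.post r), chan := ψ.cl.chan }
  ρ := fun x y => ∑ a, ∑ b,
    I.ker r (labelAt (F := S.HProc) x.1) (labelAt (F := S.HProc) y.1) a b *
      ψ.ρ (labelBack (F := S.HProc) x.1 a, x.2) (labelBack (F := S.HProc) y.1 b, y.2)

/-- The basis relabelling for the sending of a message. -/
def sendLabel (c : CConf S) (p q : S.Proc) (σ' : S.CState p) (m : S.Msg)
    (e : S.HProc p (c.proc p) ≃ S.HProc p σ' × S.HMsg m)
    (x : Idx S ⟨Function.update c.proc p σ',
      Function.update c.chan (p, q) (c.chan (p, q) ++ [m])⟩) : Idx S c :=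
  let z := ChanIdx.unsnoc m (c.chan (p, q)) (labelAt (F := fun _ => ChanIdx S) x.2)
  (labelBack (F := S.HProc) x.1 (e.symm (labelAt (F := S.HProc) x.1, z.2)),
    labelBack (F := fun _ => ChanIdx S) x.2 z.1)

/-- Processor `p` sends `m` to `q`. -/
def send (ψ : State S) (p q : S.Proc) (σ' : S.CState p) (m : S.Msg)
    (e : S.HProc p (ψ.cl.proc p) ≃ S.HProc p σ' × S.HMsg m) : State S where
  cl := { proc := Function.update ψ.cl.proc p σ'
          chan := Function.update ψ.cl.chan (p, q) (ψ.cl.chan (p, q) ++ [m]) }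
  ρ := ψ.ρ.submatrix (sendLabel ψ.cl p q σ' m e) (sendLabel ψ.cl p q σ' m e)

/-- The basis relabelling for the reception of a message. -/
def recvLabel (c : CConf S) (p q : S.Proc) (σ' : S.CState p) (m : S.Msg) (l : List S.Msg)
    (h : c.chan (q, p) = m :: l)
    (e : S.HProc p (c.proc p) × S.HMsg m ≃ S.HProc p σ')
    (x : Idx S ⟨Function.update c.proc p σ', Function.update c.chan (q, p) l⟩) : Idx S c :=
  let z := e.symm (labelAt (F := S.HProc) x.1)
  (labelBack (F := S.HProc) x.1 z.1,
    labelBack (F := fun _ => ChanIdx S) x.2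
      (cast (congrArg (ChanIdx S) h.symm) ((z.2, labelAt (F := fun _ => ChanIdx S) x.2) :
        S.HMsg m × ChanIdx S l)))

/-- Processor `p` receives `m`, the first message of the channel from `q`. -/
def recv (ψ : State S) (p q : S.Proc) (σ' : S.CState p) (m : S.Msg) (l : List S.Msg)
    (h : ψ.cl.chan (q, p) = m :: l)
    (e : S.HProc p (ψ.cl.proc p) × S.HMsg m ≃ S.HProc p σ') : State S where
  cl := { proc := Function.update ψ.cl.proc p σ'
          chan := Function.update ψ.cl.chan (q, p) l }
  ρ := ψ.ρ.submatrix (recvLabel ψ.cl p q σ' m l h e) (recvLabel ψ.cl p q σ' m l h e)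

end State

/-- `ψ'` is the state that results from the event occurring at `ψ`. -/
def ValidStep (ψ : State S) : Event S → State S → Prop
  | ⟨p, .invoke σ σ' _ e⟩, ψ' => ∃ h : σ = ψ.cl.proc p, ψ' = ψ.relabel p σ' (h ▸ e)
  | ⟨p, .respond σ σ' _ e⟩, ψ' => ∃ h : σ = ψ.cl.proc p, ψ' = ψ.relabel p σ' (h ▸ e)
  | ⟨p, .internal σ σ' e⟩, ψ' => ∃ h : σ = ψ.cl.proc p, ψ' = ψ.relabel p σ' (h ▸ e)
  | ⟨p, .apply σ I r⟩, ψ' =>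
      ∃ h : σ = ψ.cl.proc p, r ∈ I.outcomes ∧ ψ' = ψ.applyOp p (h ▸ I) r
  | ⟨p, .send q σ σ' m e⟩, ψ' => ∃ h : σ = ψ.cl.proc p, ψ' = ψ.send p q σ' m (h ▸ e)
  | ⟨p, .recv q σ σ' m e⟩, ψ' =>
      ∃ (h : σ = ψ.cl.proc p) (l : List S.Msg) (hl : ψ.cl.chan (q, p) = m :: l),
        ψ' = ψ.recv p q σ' m l hl (h ▸ e)

/-! ## Executions, algorithms, causality -/

/-- A finite execution: an initial state and the sequence of its events. -/
structure Execution (St Ev : Type u) where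
  init : St
  events : List Ev

/-- `Run step ψ es ψ'`: the events `es` lead from `ψ` to `ψ'` by steps of the transition relation. -/
inductive Run {St Ev : Type u} (step : St → Ev → St → Prop) : St → List Ev → St → Prop
  | nil (ψ : St) : Run step ψ [] ψ
  | cons {ψ ψ' ψ'' : St} {e : Ev} {es : List Ev} :
      step ψ e ψ' → Run step ψ' es ψ'' → Run step ψ (e :: es) ψ''

variable (S) in
/-- A distributed algorithm: initial states, and for every processor `p` the predicate `δ p` telling
which local steps it may take. A local step involves only the classical state of `p` before and
after, and the message sent or received. -/
structure Algorithm where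
  init : Set (State S)
  init_density : ∀ ψ ∈ init, ψ.IsDensity
  δ : ∀ p, LocalStep S p → Prop

/-- The transition relation of an algorithm. -/
def Algorithm.Step (A : Algorithm S) (ψ : State S) (e : Event S) (ψ' : State S) : Prop :=
  A.δ e.proc e.step ∧ ValidStep ψ e ψ'

/-- `X` is an execution of the algorithm `A`. -/
def Algorithm.IsExecution (A : Algorithm S) (X : Execution (State S) (Event S)) : Prop :=
  X.init ∈ A.init ∧ ∃ ψ, Run A.Step X.init X.events ψ

/-- The `i`-th and `j`-th event are the sending and the reception of the same message. As channels
are FIFO, this means that the message has the same number on a channel, counting from the messages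
that are in the channel initially. -/
def SameMessage (X : Execution (State S) (Event S)) (i j : Fin X.events.length) : Prop :=
  ∃ χ, (X.events.get i).sentOn = some χ ∧ (X.events.get j).recvOn = some χ ∧
    (X.init.cl.chan χ).length + (X.events.take i).countP (fun e => e.sentOn = some χ) =
      (X.events.take j).countP (fun e => e.recvOn = some χ)

/-- The `i`-th and `j`-th event are consecutive events on the same processor. -/
def Consecutive (X : Execution (State S) (Event S)) (i j : Fin X.events.length) : Prop :=
  i < j ∧ (X.events.get i).proc = (X.events.get j).proc ∧
    ∀ k, i < k → k < j → (X.events.get k).proc ≠ (X.events.get i).proc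

/-- Computational causality. -/
def Causal (X : Execution (State S) (Event S)) :
    Fin X.events.length → Fin X.events.length → Prop :=
  Relation.TransGen (fun i j => Consecutive X i j ∨ SameMessage X i j)

/-- `X` and `Y` are equicausal: they share the initial state and the set of events (the bijection
`f` identifies the occurrences of events), and the causal precedence relation. -/
def Equicausal (X Y : Execution (State S) (Event S)) : Prop :=
  X.init = Y.init ∧ ∃ f : Fin X.events.length ≃ Fin Y.events.length,
    (∀ i, Y.events.get (f i) = X.events.get i) ∧
    ∀ i j, Causal X i j ↔ Causal Y (f i) (f j)

/-! ## Decomposable global operations and their atomic specification -/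

variable (S) in
/-- A decomposable global operation: a product of operations on the processors and messages. -/
structure GOp where
  proc : ∀ p (σ : S.CState p), Instr (S.HProc p) S.Out (S.HProc p σ)
  msg : ∀ m : S.Msg, Instr S.HMsg S.Out (S.HMsg m)

variable (S) in
/-- The response of a processor: the outcome on the processor, and for each incoming channel (given
by its source) the outcomes on its messages, the oldest message first. -/
structure GRes where
  own : S.Out
  chans : S.Proc → List S.Out

/-- The classical part of `G` on the messages of a channel. -/
def GOp.postChan (G : GOp S) : List S.Msg → List S.Out → List S.Msg
  | m :: l, r :: rs => (G.msg m).post r :: G.postChan l rs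
  | _, _ => []

/-- Matrix elements of the tensor product of the maps of `G` on the messages of a channel. -/
def GOp.kerChan (G : GOp S) : ∀ (l : List S.Msg) (rs : List S.Out),
    ChanIdx S (G.postChan l rs) → ChanIdx S (G.postChan l rs) → ChanIdx S l → ChanIdx S l → ℂ
  | [], _, _, _, _, _ => 1
  | _ :: _, [], _, _, _, _ => 0
  | m :: l, r :: rs, x, y, a, b =>
      (G.msg m).ker r x.1 y.1 a.1 b.1 * G.kerChan l rs x.2 y.2 a.2 b.2

open Classical in
/-- `G` is applied at once to all processors and all messages in flight, with outcomes `rp p` on the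
processors and `rm χ` on the messages of channel `χ`: the quantum state becomes
`(⨂_p Λ_p ⊗ ⨂_m Λ_m)(ρ)`. -/
def State.applyGlobal (ψ : State S) (G : GOp S) (rp : S.Proc → S.Out)
    (rm : S.Proc × S.Proc → List S.Out) : State S where
  cl := { proc := fun p => (G.proc p (ψ.cl.proc p)).post (rp p)
          chan := fun χ => G.postChan (ψ.cl.chan χ) (rm χ) }
  ρ := fun x y => ∑ a, ∑ b,
    (∏ p, (G.proc p (ψ.cl.proc p)).ker (rp p) (x.1 p) (y.1 p) (a.1 p) (b.1 p)) *
    (∏ χ, G.kerChan (ψ.cl.chan χ) (rm χ) (x.2 χ) (y.2 χ) (a.2 χ) (b.2 χ)) * ψ.ρ a b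

variable (S) in
/-- State of the specification: a state of the system, and for each processor either `none` or a
global operation together with its response, if available. -/
structure SpecState where
  base : State S
  hat : S.Proc → Option (GOp S × Option (GRes S))

variable (S) in
/-- Events of the specification. -/
inductive SpecEvent : Type u
  | base (e : Event S)
  | invoke (p : S.Proc) (G : GOp S)
  | atomic (p : S.Proc) (G : GOp S) (rp : S.Proc → S.Out) (rm : S.Proc × S.Proc → List S.Out)
  | respond (p : S.Proc) (R : GRes S)

/-- The transitions of the atomic specification of `A`. -/
inductive SpecStep (A : Algorithm S) : SpecState S → SpecEvent S → SpecState S → Prop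
  | base {ψ ψ' : State S} {hat : S.Proc → Option (GOp S × Option (GRes S))} {e : Event S} :
      A.Step ψ e ψ' → SpecStep A ⟨ψ, hat⟩ (.base e) ⟨ψ', hat⟩
  | invoke {ψ : State S} {hat : S.Proc → Option (GOp S × Option (GRes S))} {p : S.Proc}
      {G : GOp S} :
      hat p = none →
      SpecStep A ⟨ψ, hat⟩ (.invoke p G) ⟨ψ, Function.update hat p (some (G, none))⟩
  | atomic {ψ : State S} {hat : S.Proc → Option (GOp S × Option (GRes S))} {p : S.Proc}
      {G : GOp S} {rp : S.Proc → S.Out} {rm : S.Proc × S.Proc → List S.Out} :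
      hat p = some (G, none) →
      (∀ q, rp q ∈ (G.proc q (ψ.cl.proc q)).outcomes) →
      (∀ χ, List.Forall₂ (fun m r => r ∈ (G.msg m).outcomes) (ψ.cl.chan χ) (rm χ)) →
      SpecStep A ⟨ψ, hat⟩ (.atomic p G rp rm)
        ⟨ψ.applyGlobal G rp rm, fun q => some (G, some ⟨rp q, fun q' => rm (q', q)⟩)⟩
  | respond {ψ : State S} {hat : S.Proc → Option (GOp S × Option (GRes S))} {p : S.Proc}
      {G : GOp S} {R : GRes S} :
      hat p = some (G, some R) →
      SpecStep A ⟨ψ, hat⟩ (.respond p R) ⟨ψ, Function.update hat p none⟩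

/-- `X` is an execution of the atomic specification of `A`. -/
def IsSpecExecution (A : Algorithm S) (X : Execution (SpecState S) (SpecEvent S)) : Prop :=
  X.init.base ∈ A.init ∧ (∀ p, X.init.hat p = none) ∧ ∃ ψ, Run (SpecStep A) X.init X.events ψ

/-! ## The QGO algorithm -/

variable (S) in
/-- The register `τ` of a processor that takes part in a global operation: the operation, the
response under construction, and the channels (given by their sources) that are waited for. -/
structure Tau where
  op : GOp S
  resp : GRes S
  waitset : Finset S.Proc

variable (S) in
/-- Where a processor is in the execution of a procedure (procedures are atomic: at a processor that
is not idle, only the next event of the procedure may occur).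
* `exec G χ`: `ProcessNewGlobalOp (G, χ)` is to apply `G` to the processor;
* `bcast G s`: the marker is still to be sent to the processors in `s`;
* `gotMsg q`: a message received from `q` is to undergo the global operation;
* `ranMsg q r`: this has been done, with outcome `r`;
* `done`: the response is to be given. -/
inductive Ctrl : Type u
  | idle
  | exec (G : GOp S) (χ : Option S.Proc)
  | bcast (G : GOp S) (s : Finset S.Proc)
  | gotMsg (q : S.Proc)
  | ranMsg (q : S.Proc) (r : S.Out)
  | done

variable (S) in
/-- Classical state of a processor in the QGO algorithm. `hand` is a received message that has not
yet been passed on to the base algorithm. -/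
structure AugState (p : S.Proc) where
  base : S.CState p
  hand : Option S.Msg
  tau : Option (Tau S)
  ctrl : Ctrl S

variable (S) in
/-- Hilbert space of the message in hand. -/
def HHand : Option S.Msg → Type
  | none => Unit
  | some m => S.HMsg m

instance hhandFintype : ∀ h : Option S.Msg, Fintype (HHand S h)
  | none => inferInstanceAs (Fintype Unit)
  | some m => inferInstanceAs (Fintype (S.HMsg m))

variable (S) in
/-- Hilbert space of a message in the QGO algorithm: markers are classical. -/
def HAugMsg : S.Msg ⊕ GOp S → Type
  | .inl m => S.HMsg m
  | .inr _ => Unit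

instance haugMsgFintype : ∀ m : S.Msg ⊕ GOp S, Fintype (HAugMsg S m)
  | .inl m => inferInstanceAs (Fintype (S.HMsg m))
  | .inr _ => inferInstanceAs (Fintype Unit)

variable (S) in
/-- The system on which the QGO algorithm runs. A message is a message of the base algorithm, or a
marker carrying a global operation. -/
abbrev aug : DistSys.{u} where
  Proc := S.Proc
  CState := AugState S
  Msg := S.Msg ⊕ GOp S
  HProc := fun p s => S.HProc p s.base × HHand S s.hand
  HMsg := HAugMsg S
  Out := S.Out
  Inv := S.Inv ⊕ GOp S
  Res := S.Res ⊕ GRes S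

section Lift
variable {p : S.Proc}

/-- A processor that is not in a procedure. -/
abbrev idleAt (σ : S.CState p) (τ : Option (Tau S)) : AugState S p := ⟨σ, none, τ, .idle⟩

/-- An operation on the base part of a processor, with nothing in hand. The registers of the QGO
algorithm become `τ r` and `c`, for the outcome `r`. -/
def liftInstr {σ : S.CState p} (I : Instr (S.HProc p) S.Out (S.HProc p σ))
    (τ : S.Out → Option (Tau S)) (c : Ctrl S) :
    Instr ((aug S).HProc p) S.Out (S.HProc p σ × Unit) where
  outcomes := I.outcomes
  post := fun r => (⟨I.post r, none, τ r, c⟩ : AugState S p)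
  map := fun r => tensorId Unit (I.map r)
  cp := fun r hr => (I.cp r hr).tensorId Unit
  tp := fun ρ => by
    have h := I.tp (fun i j => ρ (i, ()) (j, ()))
    refine Eq.trans (Finset.sum_congr rfl fun r _ => ?_) (h.trans ?_)
    · refine Eq.trans (Eq.trans ?_ (trace_tensorId Unit (I.map r) ρ)) (by simp)
      rfl
    · simp [Matrix.trace, Matrix.diag, Fintype.sum_prod_type]

/-- The operation on a message in hand; the register `ctrl` becomes `c r`, for the outcome `r`. -/
def handInstr (σ : S.CState p) {m : S.Msg} (I : Instr S.HMsg S.Out (S.HMsg m))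
    (τ : Option (Tau S)) (c : S.Out → Ctrl S) :
    Instr ((aug S).HProc p) S.Out (S.HProc p σ × S.HMsg m) where
  outcomes := I.outcomes
  post := fun r => (⟨σ, some (I.post r), τ, c r⟩ : AugState S p)
  map := fun r => idTensor (S.HProc p σ) (I.map r)
  cp := fun r hr => (I.cp r hr).idTensor (S.HProc p σ)
  tp := fun ρ => by
    refine Eq.trans (Finset.sum_congr rfl fun r _ =>
      (trace_idTensor (S.HProc p σ) (I.map r) ρ : _)) ?_
    rw [Finset.sum_comm]
    refine Eq.trans (Finset.sum_congr rfl fun c _ => I.tp _) ?_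
    simp [Matrix.trace, Matrix.diag, Fintype.sum_prod_type]

/-- A step of the base algorithm, as a step of the QGO algorithm at an idle processor. -/
def liftStep (τ : Option (Tau S)) : LocalStep S p → LocalStep (aug S) p
  | .invoke σ σ' i e =>
      .invoke (idleAt σ τ) (idleAt σ' τ) (.inl i) (e.prodCongr (Equiv.refl Unit))
  | .respond σ σ' r e =>
      .respond (idleAt σ τ) (idleAt σ' τ) (.inl r) (e.prodCongr (Equiv.refl Unit))
  | .apply σ I r => .apply (idleAt σ τ) (liftInstr I (fun _ => τ) .idle) r
  | .internal σ σ' e => .internal (idleAt σ τ) (idleAt σ' τ) (e.prodCongr (Equiv.refl Unit))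
  | .send q σ σ' m e => .send q (idleAt σ τ) (idleAt σ' τ) (.inl m)
      (((Equiv.prodPUnit _).trans e).trans
        ((Equiv.prodPUnit (S.HProc p σ')).symm.prodCongr (Equiv.refl (S.HMsg m))))
  | .recv q σ σ' m e => .recv q (idleAt σ τ) (idleAt σ' τ) (.inl m)
      ((((Equiv.prodPUnit (S.HProc p σ)).prodCongr (Equiv.refl (S.HMsg m))).trans e).trans
        (Equiv.prodPUnit (S.HProc p σ')).symm)

/-- The processor waits for the channel from `q`. -/
def Recording (τ : Option (Tau S)) (q : S.Proc) : Prop := ∃ t, τ = some t ∧ q ∈ t.waitset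

/-- The step is not the reception of a message from a channel the processor waits for. -/
def NotRecorded (τ : Option (Tau S)) : LocalStep S p → Prop
  | .recv q _ _ _ _ => ¬ Recording τ q
  | _ => True

/-- The value of the register `τ` after the processor applied `G` to itself with outcome `r`, where
`χ` is the channel (if any) on which the marker was received. -/
def newTau (G : GOp S) (χ : Option S.Proc) (r : S.Out) : Tau S where
  op := G
  resp := { own := r, chans := fun _ => [] }
  waitset := Finset.univ.filter (fun q => some q ≠ χ)

/-- `τ` after the outcome `r` of a message from `q` has been appended to its record. -/
def Tau.append (t : Tau S) (q : S.Proc) (r : S.Out) : Tau S :=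
  { t with resp := { t.resp with
      chans := Function.update t.resp.chans q (t.resp.chans q ++ [r]) } }

/-- `τ` after the channel from `q` has been closed. -/
def Tau.close (t : Tau S) (q : S.Proc) : Tau S := { t with waitset := t.waitset.erase q }

/-- The step by which the message `m` in hand, which came from `q` and on which the global operation
had outcome `r`, is recorded and then received by the base algorithm. -/
def deliverStep (t : Tau S) (q : S.Proc) (r : S.Out) (σ σ' : S.CState p) (m : S.Msg)
    (e : S.HProc p σ × S.HMsg m ≃ S.HProc p σ') : LocalStep (aug S) p :=
  .internal (⟨σ, some m, some t, .ranMsg q r⟩ : AugState S p) (idleAt σ' (some (t.append q r)))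
    (e.trans (Equiv.prodPUnit (S.HProc p σ')).symm)

end Lift

/-- The local steps of the QGO algorithm. -/
inductive QGOStep (A : Algorithm S) (p : S.Proc) : LocalStep (aug S) p → Prop
  /-- A step of the base algorithm. -/
  | base (τ : Option (Tau S)) (b : LocalStep S p) :
      A.δ p b → NotRecorded τ b → QGOStep A p (liftStep τ b)
  /-- The global operation `G` is invoked. -/
  | invoke (σ : S.CState p) (τ : Option (Tau S)) (G : GOp S) :
      QGOStep A p (.invoke (idleAt σ τ) ⟨σ, none, τ, .exec G none⟩ (.inr G) (Equiv.refl _))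
  /-- `G` is applied to the processor, and records and channels are initialized. -/
  | execProc (σ : S.CState p) (τ : Option (Tau S)) (G : GOp S) (χ : Option S.Proc) (r : S.Out) :
      QGOStep A p (.apply ⟨σ, none, τ, .exec G χ⟩
        (liftInstr (G.proc p σ) (fun r => some (newTau G χ r)) (.bcast G Finset.univ)) r)
  /-- The marker is sent to `q`. -/
  | sendMarker (σ : S.CState p) (τ : Option (Tau S)) (G : GOp S) (s : Finset S.Proc) (q : S.Proc) :
      q ∈ s →
      QGOStep A p (.send q ⟨σ, none, τ, .bcast G s⟩
        ⟨σ, none, τ, if s.erase q = ∅ then .idle else .bcast G (s.erase q)⟩ (.inr G)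
        (Equiv.prodPUnit _).symm)
  /-- The marker is received for the first time. -/
  | recvFirst (σ : S.CState p) (G : GOp S) (q : S.Proc) :
      QGOStep A p (.recv q (idleAt σ none) ⟨σ, none, none, .exec G (some q)⟩ (.inr G)
        (Equiv.prodPUnit _))
  /-- The marker is received while the global operation is underway: the channel is closed. -/
  | recvNext (σ : S.CState p) (t : Tau S) (G : GOp S) (q : S.Proc) :
      QGOStep A p (.recv q (idleAt σ (some t))
        ⟨σ, none, some (t.close q), if (t.close q).waitset = ∅ then .done else .idle⟩ (.inr G)
        (Equiv.prodPUnit _))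
  /-- All channels are closed: the processor responds. -/
  | respond (σ : S.CState p) (t : Tau S) :
      QGOStep A p (.respond ⟨σ, none, some t, .done⟩ (idleAt σ none) (.inr t.resp) (Equiv.refl _))
  /-- A message is received from a channel that the processor waits for. -/
  | intercept (σ : S.CState p) (t : Tau S) (q : S.Proc) (m : S.Msg) :
      q ∈ t.waitset →
      QGOStep A p (.recv q (idleAt σ (some t)) ⟨σ, some m, some t, .gotMsg q⟩ (.inl m)
        ((Equiv.prodPUnit (S.HProc p σ)).prodCongr (Equiv.refl (S.HMsg m))))
  /-- The global operation is applied to this message. -/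
  | execMsg (σ : S.CState p) (t : Tau S) (q : S.Proc) (m : S.Msg) (r : S.Out) :
      QGOStep A p (.apply ⟨σ, some m, some t, .gotMsg q⟩
        (handInstr σ (t.op.msg m) (some t) (fun r => .ranMsg q r)) r)
  /-- The outcome is recorded, and the base algorithm receives the message. -/
  | deliver (t : Tau S) (q : S.Proc) (r : S.Out) (σ σ' : S.CState p) (m : S.Msg)
      (e : S.HProc p σ × S.HMsg m ≃ S.HProc p σ') :
      A.δ p (.recv q σ σ' m e) → QGOStep A p (deliverStep t q r σ σ' m e)

/-- Basis labels of a channel without markers. -/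
def ChanIdx.forget : ∀ l : List S.Msg,
    ChanIdx (aug S) (l.map (Sum.inl : S.Msg → S.Msg ⊕ GOp S)) → ChanIdx S l
  | [], _ => ()
  | _ :: l, x => (x.1, ChanIdx.forget l x.2)

/-- A state of the base system, as a state of the system of the QGO algorithm in which no global
operation is underway. -/
def State.embed (ψ : State S) : State (aug S) where
  cl := { proc := fun p => (idleAt (ψ.cl.proc p) none : AugState S p)
          chan := fun χ => (ψ.cl.chan χ).map Sum.inl }
  ρ := ψ.ρ.submatrix
    (fun x => (fun p => (x.1 p).1, fun χ => ChanIdx.forget (ψ.cl.chan χ) (x.2 χ)))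
    (fun x => (fun p => (x.1 p).1, fun χ => ChanIdx.forget (ψ.cl.chan χ) (x.2 χ)))

theorem ChanIdx.forget_bijective : ∀ l : List S.Msg,
    Function.Bijective (ChanIdx.forget (S := S) l)
  | [] => ⟨fun _ _ _ => rfl, fun _ => ⟨(), rfl⟩⟩
  | m :: l => by
    obtain ⟨h1, h2⟩ := ChanIdx.forget_bijective l
    refine ⟨fun x y h => ?_, fun y => ?_⟩
    · exact Prod.ext (congrArg (fun z : S.HMsg m × ChanIdx S l => z.1) h)
        (h1 (congrArg (fun z : S.HMsg m × ChanIdx S l => z.2) h))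
    · obtain ⟨z, hz⟩ := h2 y.2
      exact ⟨(y.1, z), Prod.ext rfl hz⟩

theorem State.embed_density {ψ : State S} (h : ψ.IsDensity) : ψ.embed.IsDensity := by
  refine ⟨h.1.submatrix _, ?_⟩
  have hb : Function.Bijective (fun x : Idx (aug S) ψ.embed.cl =>
      ((fun p => (x.1 p).1, fun χ => ChanIdx.forget (ψ.cl.chan χ) (x.2 χ)) : Idx S ψ.cl)) := by
    refine ⟨fun x y hxy => ?_, fun y => ?_⟩
    · refine Prod.ext (funext fun p => ?_) (funext fun χ => ?_)
      · exact Prod.ext (congrFun (congrArg Prod.fst hxy) p) rfl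
      · exact (ChanIdx.forget_bijective _).1 (congrFun (congrArg Prod.snd hxy) χ)
    · choose z hz using fun χ => (ChanIdx.forget_bijective (ψ.cl.chan χ)).2 (y.2 χ)
      exact ⟨(fun p => (y.1 p, ()), z), Prod.ext rfl (funext hz)⟩
  have ht : ψ.embed.ρ.trace = ψ.ρ.trace := hb.sum_comp (fun i => ψ.ρ i i)
  rw [ht]
  exact h.2

/-- The QGO algorithm built on the base algorithm `A`. -/
def QGO (A : Algorithm S) : Algorithm (aug S) where
  init := State.embed '' A.init
  init_density := by
    rintro _ ⟨ψ, hψ, rfl⟩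
    exact State.embed_density (A.init_density ψ hψ)
  δ := QGOStep A

/-! ## Histories -/

/-- The event is the invocation of a global operation on processor `p`. -/
def IsGlobalInvoke (p : S.Proc) : Event (aug S) → Prop
  | ⟨q, .invoke _ _ (.inr _) _⟩ => q = p
  | _ => False

/-- The event is the response of processor `p` to a global operation. -/
def IsGlobalRespond (p : S.Proc) : Event (aug S) → Prop
  | ⟨q, .respond _ _ (.inr _) _⟩ => q = p
  | _ => False

/-- Every invocation of a global operation happens after all processors have responded to the
previous one. -/
def NoConcurrent (X : Execution (State (aug S)) (Event (aug S))) : Prop :=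
  ∀ i j : Fin X.events.length, i < j →
    (∃ p, IsGlobalInvoke p (X.events.get i)) → (∃ p, IsGlobalInvoke p (X.events.get j)) →
    ∀ q, ∃ k, i < k ∧ k < j ∧ IsGlobalRespond q (X.events.get k)

/-- Every invocation of a global operation has been responded to by all processors. -/
def NoPending (X : Execution (State (aug S)) (Event (aug S))) : Prop :=
  ∀ i : Fin X.events.length, (∃ p, IsGlobalInvoke p (X.events.get i)) →
    ∀ q, ∃ k, i < k ∧ IsGlobalRespond q (X.events.get k)

/-- The event of the QGO algorithm is an event `b` of the base algorithm. For a message that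
underwent the global operation after its arrival, this is the event at which the message is passed
on to the base algorithm. -/
inductive IsBase : Event (aug S) → Event S → Prop
  | lift {p : S.Proc} (τ : Option (Tau S)) (b : LocalStep S p) : IsBase ⟨p, liftStep τ b⟩ ⟨p, b⟩
  | deliver {p : S.Proc} (t : Tau S) (q : S.Proc) (r : S.Out) (σ σ' : S.CState p) (m : S.Msg)
      (e : S.HProc p σ × S.HMsg m ≃ S.HProc p σ') :
      IsBase ⟨p, deliverStep t q r σ σ' m e⟩ ⟨p, .recv q σ σ' m e⟩

/-- The filter for the QGO algorithm: invocations, responses, and base events. -/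
def InFilter (e : Event (aug S)) : Prop :=
  (∃ p, IsGlobalInvoke p e) ∨ (∃ p, IsGlobalRespond p e) ∨ ∃ b, IsBase e b

/-- The filter for the specification: all events but the atomic global operations. -/
def InSpecFilter : SpecEvent S → Prop
  | .atomic _ _ _ _ => False
  | _ => True

/-- The events correspond to the same action. -/
inductive SameAction : Event (aug S) → SpecEvent S → Prop
  | base {e : Event (aug S)} {b : Event S} : IsBase e b → SameAction e (.base b)
  | invoke {p : S.Proc} {s s' : AugState S p} {G : GOp S}
      {f : (aug S).HProc p s ≃ (aug S).HProc p s'} :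
      SameAction ⟨p, .invoke s s' (.inr G) f⟩ (.invoke p G)
  | respond {p : S.Proc} {s s' : AugState S p} {R : GRes S}
      {f : (aug S).HProc p s ≃ (aug S).HProc p s'} :
      SameAction ⟨p, .respond s s' (.inr R) f⟩ (.respond p R)

open Classical in
/-- The history of an execution, filtered through `F`. -/
def history {St Ev : Type u} (F : Ev → Prop) (X : Execution St Ev) : List Ev :=
  X.events.filter (fun e => F e)

/-- The histories have the same length and agree event by event. -/
def SameHistory (X : Execution (State (aug S)) (Event (aug S)))
    (Y : Execution (SpecState S) (SpecEvent S)) : Prop :=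
  List.Forall₂ SameAction (history InFilter X) (history InSpecFilter Y)

end QDist

end

open QDist

/-! The QGO algorithm is a marker algorithm in the style of Chandy and Lamport. After the invocation
of `G`, every event occurs either at a processor that `G` has not reached yet or at one that it has
reached. The events of the first kind can be moved before those of the second kind, and before the
invocation itself, without changing the order at any processor. The only obstacle would be a message
of the base algorithm sent by a reached processor and received by an unreached one. But a reached
processor sends its markers before anything else, and channels are FIFO, so such a message stays
behind a marker that its receiver has yet to receive. This gives `exists_reorder`. By
`equicausal_of_sameProcs`, keeping the order at each processor suffices for equicausality: the sends
on a channel all occur at its source and the receptions at its target, so their pairing by number is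
kept.

In the reordered run the specification can apply `G` atomically right after the invocation. The
outcomes it must use are produced only later by the QGO algorithm, so the simulation runs backwards.
It starts at the end of the wave of markers, where the two systems agree (`sim_embed`), and undoes
one event at a time (`Sim.postStep`). The state of the specification is the QGO state with all
outcomes still to come already applied. Back at the invocation, this is exactly the result of
applying `G` to the whole state (`Sim.eq_applyGlobal`).

Whether an event may occur depends on classical data only, and histories compare events only. The
argument is therefore about classical configurations; the operators are supplied at the end
(`CStep.exists_validStep`, `exists_specRun`).

As no operation is pending or concurrent with another one, the run can be cut at the invocations.
Every piece ends with empty registers and no markers, and `exists_matching` joins the pieces by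
induction. -/

noncomputable section

namespace QDist

/-! ## The classical part of a run

Whether an event may occur depends only on the classical state of the system. -/

section Classical
variable {T : DistSys.{u}}

/-- The effect of a local step on the channels. -/
inductive Act (T : DistSys.{u}) : Type u
  | none
  | snd (q : T.Proc) (m : T.Msg)
  | rcv (q : T.Proc) (m : T.Msg)

namespace LocalStep
variable {p : T.Proc}

/-- The classical state before the step. -/
def src : LocalStep T p → T.CState p
  | .invoke σ _ _ _ => σ
  | .respond σ _ _ _ => σ
  | .apply σ _ _ => σ
  | .internal σ _ _ => σ
  | .send _ σ _ _ _ => σ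
  | .recv _ σ _ _ _ => σ

/-- The classical state after the step. -/
def dst : LocalStep T p → T.CState p
  | .invoke _ σ' _ _ => σ'
  | .respond _ σ' _ _ => σ'
  | .apply _ I r => I.post r
  | .internal _ σ' _ => σ'
  | .send _ _ σ' _ _ => σ'
  | .recv _ _ σ' _ _ => σ'

/-- The outcome of the step, if any, is possible. -/
def Possible : LocalStep T p → Prop
  | .apply _ I r => r ∈ I.outcomes
  | _ => True

/-- The effect of the step on the channels. -/
def act : LocalStep T p → Act T
  | .send q _ _ m _ => .snd q m
  | .recv q _ _ m _ => .rcv q m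
  | _ => .none

end LocalStep

/-- An action of `p` changes the contents of the channels from `ch` to `ch'`. -/
def ChanStep (p : T.Proc) (ch ch' : T.Proc × T.Proc → List T.Msg) : Act T → Prop
  | .none => ch' = ch
  | .snd q m => ch' = Function.update ch (p, q) (ch (p, q) ++ [m])
  | .rcv q m => ∃ l, ch (q, p) = m :: l ∧ ch' = Function.update ch (q, p) l

/-- The classical part of an event. -/
structure CStep (c : CConf T) (e : Event T) (c' : CConf T) : Prop where
  src : c.proc e.proc = e.step.src
  possible : e.step.Possible
  dst : c'.proc = Function.update c.proc e.proc e.step.dst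
  chan : ChanStep e.proc c.chan c'.chan e.step.act

theorem ValidStep.cstep {ψ ψ' : State T} {e : Event T} (h : ValidStep ψ e ψ') :
    CStep ψ.cl e ψ'.cl := by
  obtain ⟨p, b⟩ := e
  cases b with
  | apply => obtain ⟨rfl, hr, rfl⟩ := h; exact ⟨rfl, hr, rfl, rfl⟩
  | recv => obtain ⟨rfl, l, hl, rfl⟩ := h; exact ⟨rfl, trivial, rfl, l, hl, rfl⟩
  | _ => obtain ⟨rfl, rfl⟩ := h; exact ⟨rfl, trivial, rfl, rfl⟩

theorem CConf.ext' {c c' : CConf T} (h : c.proc = c'.proc) (h' : c.chan = c'.chan) : c = c' := by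
  cases c; cases c'; cases h; cases h'; rfl

/-- Once the classical conditions hold, the new operator is given by a formula. An outcome of
probability zero is not excluded, so no condition on the operator arises. -/
theorem CStep.exists_validStep {ψ : State T} {e : Event T} {c : CConf T} (h : CStep ψ.cl e c) :
    ∃ ψ', ValidStep ψ e ψ' ∧ ψ'.cl = c := by
  obtain ⟨p, b⟩ := e
  obtain ⟨h1, h2, h3, h4⟩ := h
  cases b with
  | apply σ I r =>
    obtain rfl : ψ.cl.proc p = σ := h1
    exact ⟨_, ⟨rfl, h2, rfl⟩, CConf.ext' h3.symm h4.symm⟩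
  | recv q σ =>
    obtain rfl : ψ.cl.proc p = σ := h1
    obtain ⟨l, hl, h4⟩ := h4
    exact ⟨_, ⟨rfl, l, hl, rfl⟩, CConf.ext' h3.symm h4.symm⟩
  | send q σ =>
    obtain rfl : ψ.cl.proc p = σ := h1
    exact ⟨_, ⟨rfl, rfl⟩, CConf.ext' h3.symm h4.symm⟩
  | _ σ =>
    obtain rfl : ψ.cl.proc p = σ := h1
    exact ⟨_, ⟨rfl, rfl⟩, CConf.ext' h3.symm h4.symm⟩

/-- The classical part of a step of an algorithm. -/
def Algorithm.CStep (A : Algorithm T) (c : CConf T) (e : Event T) (c' : CConf T) : Prop :=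
  A.δ e.proc e.step ∧ QDist.CStep c e c'

section RunLemmas
variable {St Ev : Type u} {step : St → Ev → St → Prop}

theorem Run.append {a b c : St} {l l' : List Ev} (h : Run step a l b) (h' : Run step b l' c) :
    Run step a (l ++ l') c := by
  induction h with
  | nil => exact h'
  | cons h1 _ ih => exact .cons h1 (ih h')

theorem Run.split {l l' : List Ev} : ∀ {a c : St}, Run step a (l ++ l') c →
    ∃ b, Run step a l b ∧ Run step b l' c := by
  induction l with
  | nil => exact fun h => ⟨_, .nil _, h⟩
  | cons e l ih =>
    intro a c h
    cases h with
    | cons h1 h2 =>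
      obtain ⟨b, hb, hb'⟩ := ih h2
      exact ⟨b, .cons h1 hb, hb'⟩

theorem Run.mono {step' : St → Ev → St → Prop} (hs : ∀ a e b, step a e b → step' a e b)
    {a b : St} {l : List Ev} (h : Run step a l b) : Run step' a l b := by
  induction h with
  | nil => exact .nil _
  | cons h1 _ ih => exact .cons (hs _ _ _ h1) ih

/-- A run is mapped to a run of another transition system with the same events. -/
theorem Run.map {St' : Type u} {step' : St' → Ev → St' → Prop} (f : St → St')
    (hs : ∀ a e b, step a e b → step' (f a) e (f b))
    {a b : St} {l : List Ev} (h : Run step a l b) : Run step' (f a) l (f b) := by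
  induction h with
  | nil => exact .nil _
  | cons h1 _ ih => exact .cons (hs _ _ _ h1) ih

/-- A run is lifted along a map of states. -/
theorem Run.lift {St' : Type u} {step' : St' → Ev → St' → Prop} (f : St' → St)
    (hs : ∀ a e b, step (f a) e b → ∃ b', step' a e b' ∧ f b' = b)
    {a b : St} {l : List Ev} (h : Run step a l b) :
    ∀ a', f a' = a → ∃ b', Run step' a' l b' ∧ f b' = b := by
  induction h with
  | nil => exact fun a' ha => ⟨a', .nil _, ha⟩
  | cons h1 _ ih =>
    rintro a' rfl
    obtain ⟨b', hb, hb'⟩ := hs _ _ _ h1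
    obtain ⟨d, hd, hd'⟩ := ih b' hb'
    exact ⟨d, .cons hb hd, hd'⟩

end RunLemmas

theorem Algorithm.crun_of_run {A : Algorithm T} {ψ ψ' : State T} {es : List (Event T)}
    (h : Run A.Step ψ es ψ') : Run A.CStep ψ.cl es ψ'.cl :=
  h.map State.cl fun _ _ _ hs => ⟨hs.1, hs.2.cstep⟩

theorem Algorithm.run_of_crun {A : Algorithm T} {ψ : State T} {c : CConf T} {es : List (Event T)}
    (h : Run A.CStep ψ.cl es c) : ∃ ψ', Run A.Step ψ es ψ' := by
  obtain ⟨ψ', h', -⟩ := h.lift (step' := A.Step) State.cl (fun a e b hs => by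
    obtain ⟨b', h1, h2⟩ := hs.2.exists_validStep
    exact ⟨b', ⟨hs.1, h1⟩, h2⟩) ψ rfl
  exact ⟨ψ', h'⟩

/-- Two different processors share a channel only as its sender and its receiver, who act at
opposite ends of the queue. `hne` rules out the reception of the very message just sent. -/
theorem ChanStep.swap {p q : T.Proc} (hpq : p ≠ q) {ch ch₁ ch₂ : T.Proc × T.Proc → List T.Msg}
    {a b : Act T} (h1 : ChanStep p ch ch₁ a) (h2 : ChanStep q ch₁ ch₂ b)
    (hne : ∀ r m, b = .rcv r m → ch (r, q) ≠ []) :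
    ∃ ch', ChanStep q ch ch' b ∧ ChanStep p ch' ch₂ a := by
  cases a with
  | none => cases h1; exact ⟨_, h2, rfl⟩
  | snd r m =>
    cases b with
    | none => cases h2; exact ⟨_, rfl, h1⟩
    | snd r' m' =>
      cases h1; cases h2
      have h : (p, r) ≠ (q, r') := fun h => hpq (congrArg Prod.fst h)
      refine ⟨_, rfl, ?_⟩
      simp only [ChanStep, Function.update_of_ne h, Function.update_of_ne h.symm]
      exact Function.update_comm h _ _ _
    | rcv r' m' =>
      cases h1
      obtain ⟨l, hl, rfl⟩ := h2
      -- On a common channel the queue was nonempty before the send, so the reception removes an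
      -- older message.
      by_cases h : (p, r) = (r', q)
      · obtain ⟨rfl, rfl⟩ := Prod.mk.inj h
        obtain ⟨x, k, hk⟩ := List.exists_cons_of_ne_nil (hne _ _ rfl)
        simp only [Function.update_self, hk, List.cons_append, List.cons.injEq] at hl
        obtain ⟨rfl, rfl⟩ := hl
        refine ⟨_, ⟨k, hk, rfl⟩, ?_⟩
        simp [ChanStep]
      · rw [Function.update_of_ne (Ne.symm h)] at hl
        refine ⟨_, ⟨l, hl, rfl⟩, ?_⟩
        simp only [ChanStep, Function.update_of_ne h]
        exact Function.update_comm h _ _ _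
  | rcv r m =>
    obtain ⟨l, hl, rfl⟩ := h1
    cases b with
    | none => cases h2; exact ⟨_, rfl, l, hl, rfl⟩
    | snd r' m' =>
      cases h2
      by_cases h : (r, p) = (q, r')
      · obtain ⟨rfl, rfl⟩ := Prod.mk.inj h
        refine ⟨_, rfl, l ++ [m'], by simp [hl], by simp⟩
      · refine ⟨_, rfl, l, ?_, ?_⟩
        · rw [Function.update_of_ne h, hl]
        · rw [Function.update_of_ne (Ne.symm h)]
          exact Function.update_comm h _ _ _
    | rcv r' m' =>
      obtain ⟨l', hl', rfl⟩ := h2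
      have h : (r, p) ≠ (r', q) := fun h => hpq (congrArg Prod.snd h)
      rw [Function.update_of_ne h.symm] at hl'
      refine ⟨_, ⟨l', hl', rfl⟩, l, ?_, ?_⟩
      · rw [Function.update_of_ne h, hl]
      · exact Function.update_comm h _ _ _

/-- Consecutive events on different processors may be exchanged, unless the second one is the
reception of the message sent by the first one. -/
theorem CStep.swap {c c₁ c₂ : CConf T} {e x : Event T} (hp : e.proc ≠ x.proc)
    (h1 : CStep c e c₁) (h2 : CStep c₁ x c₂)
    (hne : ∀ q m, x.step.act = .rcv q m → c.chan (q, x.proc) ≠ []) :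
    ∃ c', CStep c x c' ∧ CStep c' e c₂ := by
  obtain ⟨ch, k1, k2⟩ := h1.chan.swap hp h2.chan hne
  refine ⟨⟨Function.update c.proc x.proc x.step.dst, ch⟩, ⟨?_, h2.possible, rfl, k1⟩,
    ⟨?_, h1.possible, ?_, k2⟩⟩
  · rw [← h2.src, h1.dst, Function.update_of_ne hp.symm]
  · rw [← h1.src]
    exact Function.update_of_ne hp _ _
  · rw [h2.dst, h1.dst]
    exact Function.update_comm hp _ _ _

end Classical

/-! ## Reorderings that preserve the order at each processor -/

section Reorder
variable {T : DistSys.{u}}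

/-- The lists have the same subsequence of events at every processor. -/
def SameProcs (l l' : List (Event T)) : Prop :=
  ∀ p, l.filter (fun e => e.proc = p) = l'.filter (fun e => e.proc = p)

theorem SameProcs.refl (l : List (Event T)) : SameProcs l l := fun _ => rfl

theorem SameProcs.symm {l l' : List (Event T)} (h : SameProcs l l') : SameProcs l' l :=
  fun p => (h p).symm

theorem SameProcs.trans {l l' l'' : List (Event T)} (h : SameProcs l l') (h' : SameProcs l' l'') :
    SameProcs l l'' := fun p => (h p).trans (h' p)

theorem SameProcs.append {l l' k k' : List (Event T)} (h : SameProcs l l') (h' : SameProcs k k') :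
    SameProcs (l ++ k) (l' ++ k') := fun p => by
  rw [List.filter_append, List.filter_append, h p, h' p]

theorem SameProcs.mem_iff {l l' : List (Event T)} (h : SameProcs l l') (e : Event T) :
    e ∈ l ↔ e ∈ l' := by
  have := congrArg (fun k => e ∈ k) (h e.proc)
  simpa using this

theorem SameProcs.cons_append {e : Event T} {l : List (Event T)} (h : ∀ x ∈ l, x.proc ≠ e.proc)
    (k : List (Event T)) : SameProcs (e :: (l ++ k)) (l ++ e :: k) := fun p => by
  by_cases hp : e.proc = p
  · have : l.filter (fun e => e.proc = p) = [] := by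
      simp only [List.filter_eq_nil_iff, decide_eq_true_eq]
      exact fun x hx => hp ▸ h x hx
    simp [List.filter_append, this, hp]
  · simp [List.filter_append, hp]

/-- The number of earlier events at the same processor. -/
def rank (l : List (Event T)) (i : Fin l.length) : ℕ :=
  (l.take i).countP (fun e => e.proc = (l.get i).proc)

/-- Event `i` is entry number `rank l i`, counted from zero, of the subsequence of its processor.
Processor and rank thus identify an occurrence, even if equal events repeat. -/
theorem filter_take_eq (l : List (Event T)) (i : Fin l.length) :
    (l.take i).filter (fun e => e.proc = (l.get i).proc) =
      (l.filter (fun e => e.proc = (l.get i).proc)).take (rank l i) ∧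
    (l.filter (fun e => e.proc = (l.get i).proc))[rank l i]? = some (l.get i) := by
  have h : l = l.take i ++ l.get i :: l.drop (i + 1) := by simp
  have h' : l.filter (fun e => e.proc = (l.get i).proc) =
      (l.take i).filter (fun e => e.proc = (l.get i).proc) ++ l.get i ::
        (l.drop (i + 1)).filter (fun e => e.proc = (l.get i).proc) := by
    rw [← List.filter_cons_of_pos (by simp), ← List.filter_append, ← h]
  have hr : rank l i = ((l.take i).filter (fun e => e.proc = (l.get i).proc)).length := by
    rw [rank, List.countP_eq_length_filter]
  rw [h', hr]
  simp

theorem exists_rank {p : T.Proc} : ∀ (l : List (Event T)) (n : ℕ) (e : Event T),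
    (l.filter (fun e => e.proc = p))[n]? = some e →
    ∃ i : Fin l.length, l.get i = e ∧ (l.take i).countP (fun e => e.proc = p) = n
  | [], n, e, h => by simp at h
  | x :: l, n, e, h => by
    by_cases hx : x.proc = p
    · rw [List.filter_cons_of_pos (by simpa using hx)] at h
      cases n with
      | zero => exact ⟨⟨0, by simp⟩, by simpa using h, by simp⟩
      | succ n =>
        obtain ⟨i, hi, hi'⟩ := exists_rank l n e (by simpa using h)
        exact ⟨i.succ, by simpa using hi, by simp [hi', hx]⟩
    · rw [List.filter_cons_of_neg (by simpa using hx)] at h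
      obtain ⟨i, hi, hi'⟩ := exists_rank l n e h
      exact ⟨i.succ, by simpa using hi, by simp [hi', hx]⟩

theorem rank_lt {l : List (Event T)} {i j : Fin l.length} (h : i < j)
    (hp : (l.get i).proc = (l.get j).proc) : rank l i < rank l j := by
  have h1 : (l.take j).take (i + 1) = l.take i ++ [l.get i] := by
    rw [List.take_take, min_eq_left (by exact h)]
    rw [List.take_add_one, List.getElem?_eq_getElem i.2]; rfl
  have h2 : (l.take j).countP (fun e => e.proc = (l.get j).proc) =
      ((l.take j).take (i + 1)).countP (fun e => e.proc = (l.get j).proc) +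
      ((l.take j).drop (i + 1)).countP (fun e => e.proc = (l.get j).proc) := by
    rw [← List.countP_append, List.take_append_drop]
  rw [h1, List.countP_append, List.countP_singleton] at h2
  rw [rank, rank, h2, hp]
  simp only [decide_true, if_true]
  omega

theorem rank_lt_iff {l : List (Event T)} {i j : Fin l.length}
    (hp : (l.get i).proc = (l.get j).proc) : rank l i < rank l j ↔ i < j := by
  refine ⟨fun h => ?_, fun h => rank_lt h hp⟩
  rcases lt_trichotomy i j with h' | rfl | h'
  · exact h'
  · exact absurd h (lt_irrefl _)
  · exact absurd (rank_lt h' hp.symm) h.asymm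

theorem eq_of_rank_eq {l : List (Event T)} {i j : Fin l.length}
    (hp : (l.get i).proc = (l.get j).proc) (h : rank l i = rank l j) : i = j := by
  rcases lt_trichotomy i j with h' | h' | h'
  · exact absurd (rank_lt h' hp) (by omega)
  · exact h'
  · exact absurd (rank_lt h' hp.symm) (by omega)

theorem SameProcs.exists_rank {l l' : List (Event T)} (h : SameProcs l l') (i : Fin l.length) :
    ∃ j : Fin l'.length, l'.get j = l.get i ∧ rank l' j = rank l i := by
  obtain ⟨j, hj, hj'⟩ := QDist.exists_rank l' (rank l i) (l.get i) (p := (l.get i).proc)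
    (h (l.get i).proc ▸ (filter_take_eq l i).2)
  exact ⟨j, hj, by rw [rank, hj, hj']⟩

/-- Occurrences are matched by processor and rank. Since these determine the position, the maps
obtained in the two directions are mutually inverse. -/
theorem SameProcs.exists_equiv {l l' : List (Event T)} (h : SameProcs l l') :
    ∃ f : Fin l.length ≃ Fin l'.length, ∀ i, l'.get (f i) = l.get i ∧ rank l' (f i) = rank l i := by
  choose f hf using h.exists_rank
  choose g hg using h.symm.exists_rank
  refine ⟨⟨f, g, fun i => ?_, fun j => ?_⟩, hf⟩
  · exact eq_of_rank_eq (by rw [(hg _).1, (hf _).1]) (by rw [(hg _).2, (hf _).2])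
  · exact eq_of_rank_eq (by rw [(hf _).1, (hg _).1]) (by rw [(hf _).2, (hg _).2])

/-- Events satisfying `P` all lie at the processor of event `i`, so their number before `i` does not
depend on the interleaving with other processors. -/
theorem countP_take (l : List (Event T)) (i : Fin l.length) (P : Event T → Bool)
    (hP : ∀ e, P e → e.proc = (l.get i).proc) :
    (l.take i).countP P =
      ((l.filter (fun e => e.proc = (l.get i).proc)).take (rank l i)).countP P := by
  rw [← (filter_take_eq l i).1, List.countP_filter]
  refine List.countP_congr fun e _ => ?_
  simpa using hP e

theorem proc_of_sentOn {e : Event T} {χ : T.Proc × T.Proc} (h : e.sentOn = some χ) :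
    e.proc = χ.1 := by
  obtain ⟨p, b⟩ := e
  cases b <;> simp_all [Event.sentOn]
  rw [← h]

theorem proc_of_recvOn {e : Event T} {χ : T.Proc × T.Proc} (h : e.recvOn = some χ) :
    e.proc = χ.2 := by
  obtain ⟨p, b⟩ := e
  cases b <;> simp_all [Event.recvOn]
  rw [← h]

/-- A reordering that preserves the order at each processor preserves causality. -/
theorem equicausal_of_sameProcs {X Y : Execution (State T) (Event T)} (hi : X.init = Y.init)
    (h : SameProcs X.events Y.events) : Equicausal X Y := by
  obtain ⟨f, hf⟩ := h.exists_equiv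
  have hcount : ∀ (i : Fin X.events.length) (P : Event T → Bool),
      (∀ e, P e → e.proc = (X.events.get i).proc) →
      (Y.events.take (f i)).countP P = (X.events.take i).countP P := by
    intro i P hP
    rw [countP_take _ _ P hP, countP_take _ _ P (by rw [(hf i).1]; exact hP), (hf i).1, (hf i).2, h]
  have hlt : ∀ i j, (X.events.get i).proc = (X.events.get j).proc → (f i < f j ↔ i < j) := by
    intro i j hp
    rw [← rank_lt_iff hp, ← rank_lt_iff (by rw [(hf i).1, (hf j).1, hp]), (hf i).2, (hf j).2]
  have hcons : ∀ i j, Consecutive X i j ↔ Consecutive Y (f i) (f j) := by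
    intro i j
    unfold Consecutive
    rw [(hf i).1, (hf j).1]
    constructor
    · rintro ⟨h1, h2, h3⟩
      refine ⟨(hlt i j h2).2 h1, h2, fun k hk hk' hp => ?_⟩
      obtain ⟨k, rfl⟩ := f.surjective k
      rw [(hf k).1] at hp
      exact h3 k ((hlt i k hp.symm).1 hk) ((hlt k j (hp.trans h2)).1 hk') hp
    · rintro ⟨h1, h2, h3⟩
      refine ⟨(hlt i j h2).1 h1, h2, fun k hk hk' hp => ?_⟩
      exact h3 (f k) ((hlt i k hp.symm).2 hk) ((hlt k j (hp.trans h2)).2 hk')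
        (by rw [(hf k).1, hp])
  have hmsg : ∀ i j, SameMessage X i j ↔ SameMessage Y (f i) (f j) := by
    intro i j
    unfold SameMessage
    rw [(hf i).1, (hf j).1, ← hi]
    refine exists_congr fun χ => and_congr_right fun h1 => and_congr_right fun h2 => ?_
    -- Sends on `χ` occur only at `χ.1` and receptions only at `χ.2`, so each count is local to the
    -- processor of `i` or of `j`.
    rw [hcount i _ (fun e he => ?_), hcount j _ (fun e he => ?_)]
    · rw [proc_of_recvOn h2, proc_of_recvOn (of_decide_eq_true he)]
    · rw [proc_of_sentOn h1, proc_of_sentOn (of_decide_eq_true he)]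
  refine ⟨hi, f, fun i => (hf i).1, fun i j => ?_⟩
  unfold Causal
  constructor
  · intro hc
    refine Relation.TransGen.lift (p := fun i j => Consecutive Y i j ∨ SameMessage Y i j)
      f (fun a b hab => ?_) _ _ hc
    simpa only [Function.onFun, ← hcons, ← hmsg] using hab
  · intro hc
    have := Relation.TransGen.lift
      (p := fun i j => Consecutive X i j ∨ SameMessage X i j) f.symm (fun a b hab => ?_) _ _ hc
    · simpa [Function.onFun] using this
    · simpa [Function.onFun, hcons, hmsg] using hab

end Reorder

/-! ## One global operation of the QGO algorithm -/

section Wave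
variable {S : DistSys.{u}}

/-- The action of a step of the base algorithm, as an action of the QGO algorithm. -/
def Act.lift : Act S → Act (aug S)
  | .none => .none
  | .snd q m => .snd q (.inl m)
  | .rcv q m => .rcv q (.inl m)

section LiftStep
variable {p : S.Proc} (τ : Option (Tau S)) (b : LocalStep S p)

theorem liftStep_src : (liftStep τ b).src = idleAt b.src τ := by cases b <;> rfl

theorem liftStep_dst : (liftStep τ b).dst = idleAt b.dst τ := by cases b <;> rfl

theorem liftStep_possible : (liftStep τ b).Possible ↔ b.Possible := by cases b <;> rfl

theorem liftStep_act : (liftStep τ b).act = b.act.lift := by cases b <;> rfl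

end LiftStep

/-- The processor has sent the marker to `q`. -/
def AugState.sent {p : S.Proc} (s : AugState S p) (q : S.Proc) : Prop :=
  match s.ctrl with
  | .exec _ _ => False
  | .bcast _ l => q ∉ l
  | _ => True

/-- The processor has received the marker from `q`. -/
def AugState.got {p : S.Proc} (s : AugState S p) (q : S.Proc) : Prop :=
  match s.tau with
  | some t => q ∉ t.waitset
  | none => match s.ctrl with
    | .exec _ χ => χ = some q
    -- An empty register outside `exec` means that the operation is complete here. Processors not
    -- yet reached look the same and are excluded in `Got`.
    | _ => True

/-- The possible states of a processor after the global operation `G` has reached it. -/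
inductive Started (G : GOp S) {p : S.Proc} : AugState S p → Prop
  | fin (σ : S.CState p) : Started G (idleAt σ none)
  | exec (σ : S.CState p) (χ : Option S.Proc) : Started G ⟨σ, none, none, .exec G χ⟩
  | bcast (σ : S.CState p) (t : Tau S) (s : Finset S.Proc) :
      t.op = G → Started G ⟨σ, none, some t, .bcast G s⟩
  | idle (σ : S.CState p) (t : Tau S) : t.op = G → Started G (idleAt σ (some t))
  | gotMsg (σ : S.CState p) (t : Tau S) (q : S.Proc) (m : S.Msg) :
      t.op = G → q ∈ t.waitset → Started G ⟨σ, some m, some t, .gotMsg q⟩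
  | ranMsg (σ : S.CState p) (t : Tau S) (q : S.Proc) (m : S.Msg) (r : S.Out) :
      t.op = G → q ∈ t.waitset → Started G ⟨σ, some m, some t, .ranMsg q r⟩
  | done (σ : S.CState p) (t : Tau S) :
      t.op = G → t.waitset = ∅ → Started G ⟨σ, none, some t, .done⟩

/-- The marker has been sent from `a` to `b`; `U` are the processors not yet reached. -/
def Sent (U : Set S.Proc) (c : CConf (aug S)) (a b : S.Proc) : Prop :=
  a ∉ U ∧ AugState.sent (c.proc a) b

/-- The marker from `a` has been received by `b`. -/
def Got (U : Set S.Proc) (c : CConf (aug S)) (a b : S.Proc) : Prop :=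
  b ∉ U ∧ AugState.got (c.proc b) a

/-- The channel contains no marker. -/
def NoMark (L : List (S.Msg ⊕ GOp S)) : Prop := ∃ l : List S.Msg, L = l.map Sum.inl

/-- The channel contains exactly one marker. -/
def OneMark (G : GOp S) (L : List (S.Msg ⊕ GOp S)) : Prop :=
  ∃ l₁ l₂ : List S.Msg, L = l₁.map Sum.inl ++ Sum.inr G :: l₂.map Sum.inl

/-- The content of a channel, according to whether the marker was sent and received. -/
inductive Shape (G : GOp S) (sent got : Prop) (L : List (S.Msg ⊕ GOp S)) : Prop
  | before : ¬ sent → ¬ got → NoMark L → Shape G sent got L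
  | inFlight : sent → ¬ got → OneMark G L → Shape G sent got L
  | after : sent → got → NoMark L → Shape G sent got L

theorem NoMark.append {L : List (S.Msg ⊕ GOp S)} (h : NoMark L) (m : S.Msg) :
    NoMark (L ++ [Sum.inl m]) := by
  obtain ⟨l, rfl⟩ := h
  exact ⟨l ++ [m], by simp⟩

theorem NoMark.append_marker {G : GOp S} {L : List (S.Msg ⊕ GOp S)} (h : NoMark L) :
    OneMark G (L ++ [Sum.inr G]) := by
  obtain ⟨l, rfl⟩ := h
  exact ⟨l, [], by simp⟩

theorem NoMark.tail {L : List (S.Msg ⊕ GOp S)} {m : S.Msg} (h : NoMark (Sum.inl m :: L)) :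
    NoMark L := by
  obtain ⟨_ | ⟨x, l⟩, h⟩ := h
  · simp at h
  · exact ⟨l, by simpa using (List.cons.inj h).2⟩

theorem not_noMark_cons {L : List (S.Msg ⊕ GOp S)} {G : GOp S} : ¬ NoMark (Sum.inr G :: L) := by
  rintro ⟨_ | ⟨x, l⟩, h⟩ <;> simp at h

theorem OneMark.append {G : GOp S} {L : List (S.Msg ⊕ GOp S)} (h : OneMark G L) (m : S.Msg) :
    OneMark G (L ++ [Sum.inl m]) := by
  obtain ⟨l, l', rfl⟩ := h
  exact ⟨l, l' ++ [m], by simp⟩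

theorem OneMark.tail {G : GOp S} {L : List (S.Msg ⊕ GOp S)} {m : S.Msg}
    (h : OneMark G (Sum.inl m :: L)) : OneMark G L := by
  obtain ⟨_ | ⟨x, l⟩, l', h⟩ := h
  · simp at h
  · exact ⟨l, l', by simpa using (List.cons.inj h).2⟩

theorem OneMark.cons {G G' : GOp S} {L : List (S.Msg ⊕ GOp S)}
    (h : OneMark G (Sum.inr G' :: L)) : G' = G ∧ NoMark L := by
  obtain ⟨_ | ⟨x, l⟩, l', h⟩ := h
  · simp only [List.map_nil, List.nil_append, List.cons.injEq, Sum.inr.injEq] at h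
    exact ⟨h.1, l', h.2⟩
  · simp at h

namespace Shape
variable {G G' : GOp S} {s g : Prop} {L : List (S.Msg ⊕ GOp S)} {m : S.Msg}

theorem append (h : Shape G s g L) (m : S.Msg) : Shape G s g (L ++ [Sum.inl m]) := by
  cases h with
  | before h1 h2 h3 => exact .before h1 h2 (h3.append m)
  | inFlight h1 h2 h3 => exact .inFlight h1 h2 (h3.append m)
  | after h1 h2 h3 => exact .after h1 h2 (h3.append m)

theorem tail (h : Shape G s g (Sum.inl m :: L)) : Shape G s g L := by
  cases h with
  | before h1 h2 h3 => exact .before h1 h2 h3.tail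
  | inFlight h1 h2 h3 => exact .inFlight h1 h2 h3.tail
  | after h1 h2 h3 => exact .after h1 h2 h3.tail

theorem marker (h : Shape G s g (Sum.inr G' :: L)) : G' = G ∧ s ∧ ¬ g ∧ NoMark L := by
  cases h with
  | before h1 h2 h3 => exact absurd h3 not_noMark_cons
  | inFlight h1 h2 h3 => exact ⟨h3.cons.1, h1, h2, h3.cons.2⟩
  | after h1 h2 h3 => exact absurd h3 not_noMark_cons

theorem of_not_sent (h : Shape G s g L) (hs : ¬ s) : ¬ g ∧ NoMark L := by
  cases h with
  | before h1 h2 h3 => exact ⟨h2, h3⟩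
  | inFlight h1 h2 h3 => exact absurd h1 hs
  | after h1 h2 h3 => exact absurd h1 hs

theorem of_inFlight (h : Shape G s g L) (hs : s) (hg : ¬ g) : OneMark G L := by
  cases h with
  | before h1 h2 h3 => exact absurd hs h1
  | inFlight h1 h2 h3 => exact h3
  | after h1 h2 h3 => exact absurd h2 hg

theorem of_got (h : Shape G s g L) (hg : g) : NoMark L := by
  cases h with
  | before h1 h2 h3 => exact h3
  | inFlight h1 h2 h3 => exact absurd hg h2
  | after h1 h2 h3 => exact h3

end Shape

/-- The invariant of the QGO algorithm during a global operation `G` that has not yet reached the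
processors in `U`. -/
structure WaveInv (G : GOp S) (U : Set S.Proc) (c : CConf (aug S)) : Prop where
  un : ∀ p ∈ U, ∃ σ, c.proc p = (idleAt σ none : AugState S p)
  started : ∀ p ∉ U, Started (p := p) G (c.proc p)
  shape : ∀ a b, Shape G (Sent U c a b) (Got U c a b) (c.chan (a, b))

section Update
variable {U U' : Set S.Proc} {c c' : CConf (aug S)} {p : S.Proc} {s' : AugState S p}

/-- `D` collects the destinations to which the step newly sends the marker. -/
theorem sent_update (hU : ∀ x, x ≠ p → (x ∈ U' ↔ x ∈ U))
    (hp : c'.proc = Function.update c.proc p s') {D : S.Proc → Prop}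
    (h : ∀ b, (p ∉ U' ∧ s'.sent b) ↔ (p ∉ U ∧ AugState.sent (c.proc p) b) ∨ D b) (a b : S.Proc) :
    Sent U' c' a b ↔ Sent U c a b ∨ (a = p ∧ D b) := by
  unfold Sent
  by_cases ha : a = p
  · subst ha
    rw [hp, Function.update_self, h b]
    simp
  · rw [hp, Function.update_of_ne ha, hU a ha]
    simp [ha]

theorem got_update (hU : ∀ x, x ≠ p → (x ∈ U' ↔ x ∈ U))
    (hp : c'.proc = Function.update c.proc p s') {D : S.Proc → Prop}
    (h : ∀ a, (p ∉ U' ∧ s'.got a) ↔ (p ∉ U ∧ AugState.got (c.proc p) a) ∨ D a) (a b : S.Proc) :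
    Got U' c' a b ↔ Got U c a b ∨ (b = p ∧ D a) := by
  unfold Got
  by_cases ha : b = p
  · subst ha
    rw [hp, Function.update_self, h a]
    simp
  · rw [hp, Function.update_of_ne ha, hU b ha]
    simp [ha]

/-- Only `p` changes; `D` and `E` are the destinations and the sources of the markers that it newly
sends and receives. Apart from the shapes of the channels, all that has to be checked is local to
`p`. -/
theorem WaveInv.update {G : GOp S} (hw : WaveInv G U c) (hU : ∀ x, x ≠ p → (x ∈ U' ↔ x ∈ U))
    (hp : c'.proc = Function.update c.proc p s')
    (hun : p ∈ U' → ∃ σ, s' = (idleAt σ none : AugState S p)) (hst : p ∉ U' → Started G s')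
    (D E : S.Proc → Prop)
    (hs : ∀ b, (p ∉ U' ∧ s'.sent b) ↔ (p ∉ U ∧ AugState.sent (c.proc p) b) ∨ D b)
    (hg : ∀ a, (p ∉ U' ∧ s'.got a) ↔ (p ∉ U ∧ AugState.got (c.proc p) a) ∨ E a)
    (hsh : ∀ a b, Shape G (Sent U c a b ∨ (a = p ∧ D b)) (Got U c a b ∨ (b = p ∧ E a))
      (c'.chan (a, b))) : WaveInv G U' c' := by
  refine ⟨fun x hx => ?_, fun x hx => ?_, fun a b => ?_⟩
  · by_cases h : x = p
    · subst h
      rw [hp, Function.update_self]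
      exact hun hx
    · rw [hp, Function.update_of_ne h]
      exact hw.un x ((hU x h).1 hx)
  · by_cases h : x = p
    · subst h
      rw [hp, Function.update_self]
      exact hst hx
    · rw [hp, Function.update_of_ne h]
      exact hw.started x (fun h' => hx ((hU x h).2 h'))
  · rw [propext (sent_update hU hp hs a b), propext (got_update hU hp hg a b)]
    exact hsh a b

/-- The case that no marker is sent or received. -/
theorem WaveInv.update_base {G : GOp S} (hw : WaveInv G U c)
    (hU : ∀ x, x ≠ p → (x ∈ U' ↔ x ∈ U))
    (hp : c'.proc = Function.update c.proc p s')
    (hun : p ∈ U' → ∃ σ, s' = (idleAt σ none : AugState S p)) (hst : p ∉ U' → Started G s')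
    (hs : ∀ b, (p ∉ U' ∧ s'.sent b) ↔ (p ∉ U ∧ AugState.sent (c.proc p) b))
    (hg : ∀ a, (p ∉ U' ∧ s'.got a) ↔ (p ∉ U ∧ AugState.got (c.proc p) a))
    {a : Act S} (hch : ChanStep (T := aug S) p c.chan c'.chan a.lift) : WaveInv G U' c' := by
  refine hw.update hU hp hun hst (fun _ => False) (fun _ => False) (by simpa using hs)
    (by simpa using hg) fun x y => ?_
  simp only [and_false, or_false]
  have h := hw.shape x y
  cases a with
  | none => rw [show c'.chan = c.chan from hch]; exact h
  | snd q m =>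
    rw [show c'.chan = _ from hch]
    by_cases hxy : (x, y) = (p, q)
    · rw [← hxy, Function.update_self]
      exact h.append m
    · rw [Function.update_of_ne hxy]
      exact h
  | rcv q m =>
    obtain ⟨l, hl, hch⟩ := hch
    rw [hch]
    by_cases hxy : (x, y) = (q, p)
    · rw [← hxy] at hl
      rw [← hxy, Function.update_self]
      rw [hl] at h
      exact h.tail
    · rw [Function.update_of_ne hxy]
      exact h

end Update

/-- A step of the base algorithm at a processor not yet reached by the global operation. -/
def PreStep (A : Algorithm S) (U : Set S.Proc) (c : CConf (aug S)) (e : Event (aug S))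
    (c' : CConf (aug S)) : Prop :=
  (∃ (p : S.Proc) (b : LocalStep S p), p ∈ U ∧ A.δ p b ∧ e = ⟨p, liftStep none b⟩) ∧ CStep c e c'

/-- A step of the QGO algorithm at a processor that has been reached by the global operation, or at
which it starts. -/
def PostStep (A : Algorithm S) (x : Set S.Proc × CConf (aug S)) (e : Event (aug S))
    (y : Set S.Proc × CConf (aug S)) : Prop :=
  QGOStep A e.proc e.step ∧ (∀ q, ¬ IsGlobalInvoke q e) ∧ CStep x.2 e y.2 ∧
    y.1 = x.1 \ {e.proc} ∧ (e.proc ∈ x.1 → AugState.ctrl e.step.dst ≠ .idle)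

theorem diff_singleton_mem_iff {α : Type u} (U : Set α) (p : α) :
    ∀ x, x ≠ p → (x ∈ U \ {p} ↔ x ∈ U) := fun x hx => by simp [hx]

/-- An unreached processor is idle with an empty register, so without a new invocation it can only
run the base algorithm or receive its first marker. The former keeps `U`; the latter, like every
step at a reached processor, is a `PostStep`. A first marker leads to the control `exec`, while base
steps end in `idle`; the last clause of `PostStep` tells the two apart by this. -/
theorem WaveInv.step {A : Algorithm S} {G : GOp S} {U : Set S.Proc} {c c' : CConf (aug S)}
    {e : Event (aug S)} (hw : WaveInv G U c) (hq : (QGO A).CStep c e c')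
    (hi : ∀ q, ¬ IsGlobalInvoke q e) :
    (PreStep A U c e c' ∧ WaveInv G U c') ∨
      (PostStep A (U, c) e (U \ {e.proc}, c') ∧ WaveInv G (U \ {e.proc}) c') := by
  obtain ⟨p, b⟩ := e
  obtain ⟨hq, hc⟩ := hq
  replace hq : QGOStep A p b := hq
  have hpost : (p ∈ U → AugState.ctrl b.dst ≠ .idle) → WaveInv G (U \ {p}) c' →
      (PreStep A U c ⟨p, b⟩ c' ∧ WaveInv G U c') ∨
      (PostStep A (U, c) ⟨p, b⟩ (U \ {p}, c') ∧ WaveInv G (U \ {p}) c') :=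
    fun h h' => .inr ⟨⟨hq, hi, hc, rfl, h⟩, h'⟩
  have hnot : p ∉ U \ {p} := fun h => h.2 rfl
  have hU := diff_singleton_mem_iff U p
  have hsrc : c.proc p = b.src := hc.src
  have hdst : c'.proc = Function.update c.proc p b.dst := hc.dst
  have hch : ChanStep (T := aug S) p c.chan c'.chan b.act := hc.chan
  have hloc : p ∉ U → Started (p := p) G b.src := fun h => hsrc ▸ hw.started p h
  have hpU : AugState.ctrl b.src ≠ .idle ∨ AugState.tau b.src ≠ none → p ∉ U := by
    intro hx hU
    obtain ⟨σ, hσ⟩ := hw.un p hU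
    rw [← hsrc, hσ] at hx
    simp at hx
  cases hq with
  | base τ b h1 h2 =>
    replace hloc : p ∉ U → Started (p := p) G (idleAt b.src τ) :=
      fun h => liftStep_src τ b ▸ hloc h
    replace hsrc : c.proc p = idleAt b.src τ := hsrc.trans (liftStep_src τ b)
    replace hdst : c'.proc = Function.update c.proc p (idleAt b.dst τ) :=
      hdst.trans (by rw [← liftStep_dst τ b])
    replace hch : ChanStep (T := aug S) p c.chan c'.chan b.act.lift := liftStep_act τ b ▸ hch
    by_cases hp : p ∈ U
    · obtain rfl : τ = none := by
        obtain ⟨σ, hσ⟩ := hw.un p hp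
        rw [hsrc] at hσ
        exact congrArg AugState.tau hσ
      refine .inl ⟨⟨⟨p, b, hp, h1, rfl⟩, hc⟩, ?_⟩
      exact hw.update_base (fun _ _ => Iff.rfl) hdst (fun _ => ⟨_, rfl⟩) (fun h => absurd hp h)
        (fun _ => by simp [hp]) (fun _ => by simp [hp]) hch
    · refine hpost (fun h => absurd h hp) (hw.update_base hU hdst (fun h => absurd h hnot)
        (fun _ => ?_) (fun _ => ?_) (fun _ => ?_) hch)
      · have := hloc hp
        cases this with
        | fin => exact .fin _
        | idle _ _ h => exact .idle _ _ h
      · simp [hp, hsrc, AugState.sent]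
      · simp [hp, hsrc, AugState.got]
  | invoke => exact absurd rfl (hi p)
  | execProc σ τ G' χ r =>
    have hp := hpU (.inl (by simp [LocalStep.src]))
    obtain ⟨rfl, rfl⟩ : G' = G ∧ τ = none := by cases hloc hp; exact ⟨rfl, rfl⟩
    refine hpost (fun h => absurd h hp) (hw.update_base hU hdst (fun h => absurd h hnot)
        (fun _ => .bcast _ _ _ rfl) (fun _ => ?_) (fun _ => ?_) (a := .none) hch)
    · simp [hp, hsrc, LocalStep.src, LocalStep.dst, liftInstr, AugState.sent]
    -- The new waitset contains all sources but `χ`, so the same markers count as received before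
    -- and after.
    · simp [hp, hsrc, LocalStep.src, LocalStep.dst, liftInstr, AugState.got, newTau, eq_comm]
  | sendMarker σ τ G' s q hqs =>
    have hp := hpU (.inl (by simp [LocalStep.src]))
    obtain ⟨rfl, t, rfl, ht⟩ : G' = G ∧ ∃ t, τ = some t ∧ t.op = G := by
      cases hloc hp with | bcast _ t _ h => exact ⟨rfl, t, rfl, h⟩
    refine hpost (fun h => absurd h hp) (hw.update hU hdst (fun h => absurd h hnot)
        (fun _ => ?_) (fun x => x = q) (fun _ => False) (fun x => ?_) (fun _ => ?_) fun x y => ?_)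
    · change Started G' (AugState.mk σ none (some t)
        (if s.erase q = ∅ then Ctrl.idle else Ctrl.bcast G' (s.erase q)))
      split_ifs
      · exact .idle _ _ ht
      · exact .bcast _ _ _ ht
    -- After the last marker the control is `idle`, where all markers count as sent. This is
    -- consistent, because then `s` contains nothing but `q`.
    · by_cases hs : s.erase q = ∅
      · have : x ∉ s.erase q := by simp [hs]
        simp only [Finset.mem_erase, not_and_or, not_not] at this
        simp [hp, hsrc, LocalStep.src, LocalStep.dst, AugState.sent, hs]
        tauto
      · simp [hp, hsrc, LocalStep.src, LocalStep.dst, AugState.sent, hs]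
        tauto
    · simp [hp, hsrc, LocalStep.src, LocalStep.dst, AugState.got]
    · rw [show c'.chan = _ from hch]
      have h := hw.shape x y
      by_cases hxy : (x, y) = (p, q)
      · obtain ⟨rfl, rfl⟩ := Prod.mk.inj hxy
        obtain ⟨h1, h2⟩ := h.of_not_sent (by
          simp [Sent, hsrc, LocalStep.src, AugState.sent, hqs])
        rw [Function.update_self]
        exact .inFlight (by simp) (by simpa using h1) h2.append_marker
      · rw [Function.update_of_ne hxy]
        have : ¬ (x = p ∧ y = q) := by simpa using hxy
        simpa [this] using h
  | recvFirst σ G' q =>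
    obtain ⟨l, hl, hch⟩ := hch
    have hsh := hw.shape q p
    rw [hl] at hsh
    obtain ⟨rfl, h1, h2, h3⟩ := hsh.marker
    -- A reached idle processor with empty register has received all markers, whereas the one at the
    -- head of this channel has not been received.
    have hp : p ∈ U := by
      by_contra hp
      exact h2 ⟨hp, by simp [hsrc, LocalStep.src, AugState.got]⟩
    refine hpost (fun _ => by simp [LocalStep.dst]) (hw.update hU hdst (fun h => absurd h hnot)
        (fun _ => .exec _ _) (fun _ => False) (fun x => x = q) (fun x => ?_) (fun x => ?_)
        fun x y => ?_)
    · simp [hp, LocalStep.dst, AugState.sent]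
    · simp [hp, LocalStep.dst, AugState.got, eq_comm]
    · rw [hch]
      have h := hw.shape x y
      by_cases hxy : (x, y) = (q, p)
      · obtain ⟨rfl, rfl⟩ := Prod.mk.inj hxy
        rw [Function.update_self]
        exact .after (.inl h1) (.inr ⟨rfl, rfl⟩) h3
      · rw [Function.update_of_ne hxy]
        have : ¬ (y = p ∧ x = q) := by simpa [and_comm] using hxy
        simpa [this] using h
  | recvNext σ t G' q =>
    obtain ⟨l, hl, hch⟩ := hch
    have hp := hpU (.inr (by simp [LocalStep.src]))
    have ht : t.op = G := by cases hloc hp with | idle _ _ h => exact h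
    have hsh := hw.shape q p
    rw [hl] at hsh
    obtain ⟨rfl, h1, h2, h3⟩ := hsh.marker
    refine hpost (fun h => absurd h hp) (hw.update hU hdst (fun h => absurd h hnot)
        (fun _ => ?_) (fun _ => False) (fun x => x = q) (fun x => ?_) (fun x => ?_)
        fun x y => ?_)
    · change Started G' (AugState.mk σ none (some (t.close q))
        (if (t.close q).waitset = ∅ then Ctrl.done else Ctrl.idle))
      split_ifs with h
      · exact .done _ _ ht h
      · exact .idle _ _ ht
    · by_cases h : (t.close q).waitset = ∅ <;>
        simp [hp, hsrc, LocalStep.src, LocalStep.dst, AugState.sent, h]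
    · simp [hp, hsrc, LocalStep.src, LocalStep.dst, AugState.got, Tau.close]
      tauto
    · rw [hch]
      have h := hw.shape x y
      by_cases hxy : (x, y) = (q, p)
      · obtain ⟨rfl, rfl⟩ := Prod.mk.inj hxy
        rw [Function.update_self]
        exact .after (.inl h1) (.inr ⟨rfl, rfl⟩) h3
      · rw [Function.update_of_ne hxy]
        have : ¬ (y = p ∧ x = q) := by simpa [and_comm] using hxy
        simpa [this] using h
  | respond σ t =>
    have hp := hpU (.inr (by simp [LocalStep.src]))
    have ht : t.waitset = ∅ := by cases hloc hp with | done _ _ _ h => exact h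
    refine hpost (fun h => absurd h hp) (hw.update_base hU hdst (fun h => absurd h hnot)
        (fun _ => .fin _) (fun _ => ?_) (fun _ => ?_) (a := .none) hch)
    · simp [hp, hsrc, LocalStep.src, LocalStep.dst, AugState.sent]
    · simp [hp, hsrc, LocalStep.src, LocalStep.dst, AugState.got, ht]
  | intercept σ t q m hm =>
    have hp := hpU (.inr (by simp [LocalStep.src]))
    have ht : t.op = G := by cases hloc hp with | idle _ _ h => exact h
    refine hpost (fun h => absurd h hp) (hw.update_base hU hdst (fun h => absurd h hnot)
        (fun _ => .gotMsg _ _ _ _ ht hm) (fun _ => ?_) (fun _ => ?_) (a := .rcv q m) hch)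
    · simp [hp, hsrc, LocalStep.src, LocalStep.dst, AugState.sent]
    · simp [hp, hsrc, LocalStep.src, LocalStep.dst, AugState.got]
  | execMsg σ t q m r =>
    have hp := hpU (.inr (by simp [LocalStep.src]))
    obtain ⟨ht, hm⟩ : t.op = G ∧ q ∈ t.waitset := by
      cases hloc hp with | gotMsg _ _ _ _ h h' => exact ⟨h, h'⟩
    refine hpost (fun h => absurd h hp) (hw.update_base hU hdst (fun h => absurd h hnot)
        (fun _ => .ranMsg _ _ _ _ _ ht hm) (fun _ => ?_) (fun _ => ?_) (a := .none) hch)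
    · simp [hp, hsrc, LocalStep.src, LocalStep.dst, AugState.sent, handInstr]
    · simp [hp, hsrc, LocalStep.src, LocalStep.dst, AugState.got, handInstr]
  | deliver t q r σ σ' m e hδ =>
    have hp := hpU (.inr (by simp [LocalStep.src, deliverStep]))
    have ht : t.op = G := by cases hloc hp with | ranMsg _ _ _ _ _ h h' => exact h
    refine hpost (fun h => absurd h hp) (hw.update_base hU hdst (fun h => absurd h hnot)
        (fun _ => .idle _ _ ht) (fun _ => ?_) (fun _ => ?_) (a := .none) hch)
    · simp [hp, hsrc, LocalStep.src, LocalStep.dst, AugState.sent, deliverStep]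
    · simp [hp, hsrc, LocalStep.src, LocalStep.dst, AugState.got, deliverStep, Tau.append]

end Wave

/-! ### Moving the events at unreached processors to the front. -/

section Reordering
variable {S : DistSys.{u}} {A : Algorithm S} {G : GOp S}

theorem WaveInv.preStep {U V : Set S.Proc} {c c' : CConf (aug S)} {e : Event (aug S)}
    (hw : WaveInv G U c) (hVU : V ⊆ U) (h : PreStep A V c e c') : WaveInv G U c' := by
  obtain ⟨⟨p, b, hp, hb, rfl⟩, hc⟩ := h
  have hq : QGOStep A p (liftStep none b) := .base none b hb (by
    cases b <;> simp [NotRecorded, Recording])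
  rcases hw.step (A := A) (e := ⟨p, liftStep none b⟩) ⟨hq, hc⟩ (fun q => by cases b <;> exact id) with h | h
  · exact h.2
  -- The other alternative would leave an unreached processor outside `idle`, but a lifted base step
  -- ends in `idle`.
  · refine absurd ?_ (h.1.2.2.2.2 (hVU hp))
    exact congrArg AugState.ctrl (liftStep_dst none b)

theorem WaveInv.postStep {x y : Set S.Proc × CConf (aug S)} {e : Event (aug S)}
    (hw : WaveInv G x.1 x.2) (h : PostStep A x e y) : WaveInv G y.1 y.2 := by
  obtain ⟨h1, h2, h3, h4, h5⟩ := h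
  rcases hw.step ⟨h1, h3⟩ h2 with ⟨⟨⟨p, b, hp, hb, rfl⟩, -⟩, -⟩ | h
  · exact absurd (congrArg AugState.ctrl (liftStep_dst none b)) (h5 hp)
  · rw [h4]
    exact h.2

theorem PreStep.mono {U V : Set S.Proc} (hVU : V ⊆ U) {c c' : CConf (aug S)} {e : Event (aug S)}
    (h : PreStep A V c e c') : PreStep A U c e c' := by
  obtain ⟨⟨p, b, hp, hb, rfl⟩, hc⟩ := h
  exact ⟨⟨p, b, hVU hp, hb, rfl⟩, hc⟩

theorem PreStep.cstep {U : Set S.Proc} {c c' : CConf (aug S)} {e : Event (aug S)}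
    (h : PreStep A U c e c') : (QGO A).CStep c e c' := by
  obtain ⟨⟨p, b, hp, hb, rfl⟩, hc⟩ := h
  exact ⟨.base none b hb (by cases b <;> simp [NotRecorded, Recording]), hc⟩

theorem Run.proc_mem {U : Set S.Proc} {c c' : CConf (aug S)} {l : List (Event (aug S))}
    (h : Run (PreStep A U) c l c') : ∀ x ∈ l, x.proc ∈ U := by
  induction h with
  | nil => simp
  | cons h1 _ ih =>
    obtain ⟨⟨p, b, hp, hb, rfl⟩, hc⟩ := h1
    simpa using ⟨hp, ih⟩

/-- The event sends no message of the base algorithm on an empty channel to a processor in `V`. -/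
def NoFirstSend (V : Set S.Proc) (c : CConf (aug S)) (e : Event (aug S)) : Prop :=
  ∀ q m, e.step.act = .snd q (.inl m) → q ∈ V → c.chan (e.proc, q) ≠ []

/-- If the channel from which `x` receives was empty before `e`, then `e` has sent the message
received by `x`. That message belongs to the base algorithm, as `x` receives no markers, so
`NoFirstSend` forbids this. -/
theorem PreStep.swap {V : Set S.Proc} {c c₁ c₂ : CConf (aug S)} {e x : Event (aug S)}
    (he : CStep c e c₁) (hV : e.proc ∉ V) (hs : NoFirstSend V c e) (hx : PreStep A V c₁ x c₂) :
    ∃ c', PreStep A V c x c' ∧ CStep c' e c₂ := by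
  obtain ⟨⟨p, b, hp, hb, rfl⟩, hx⟩ := hx
  have hep : e.proc ≠ p := fun h => hV (h ▸ hp)
  obtain ⟨c', h1, h2⟩ := he.swap hep hx (fun q m hm => by
    have hch := hx.chan
    obtain ⟨m', rfl⟩ : ∃ m', m = .inl m' := by
      replace hm : b.act.lift = Act.rcv q m := (liftStep_act none b).symm.trans hm
      cases hb : b.act <;> rw [hb] at hm <;> simp [Act.lift] at hm
      exact ⟨_, hm.2.symm⟩
    rw [hm] at hch
    obtain ⟨l, hl, -⟩ := hch
    intro hnil
    change c.chan (q, p) = [] at hnil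
    change c₁.chan (q, p) = _ at hl
    have hech := he.chan
    cases hact : e.step.act with
    | none =>
      rw [hact] at hech
      rw [show c₁.chan = c.chan from hech, hnil] at hl
      cases hl
    | snd q' m'' =>
      rw [hact] at hech
      rw [show c₁.chan = _ from hech] at hl
      by_cases hq : (q, p) = (e.proc, q')
      · obtain ⟨rfl, rfl⟩ := Prod.mk.inj hq
        rw [Function.update_self, hnil] at hl
        obtain ⟨rfl, -⟩ := List.cons.inj hl
        exact hs _ _ hact hp hnil
      · rw [Function.update_of_ne hq, hnil] at hl
        cases hl
    | rcv q' m'' =>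
      rw [hact] at hech
      obtain ⟨l', -, hech⟩ := hech
      have hq : (q, p) ≠ (q', e.proc) := fun h => hep (congrArg Prod.snd h).symm
      rw [hech, Function.update_of_ne hq, hnil] at hl
      cases hl)
  exact ⟨c', ⟨⟨p, b, hp, hb, rfl⟩, h1⟩, h2⟩

/-- An event at a processor reached by the global operation may be moved behind events at
processors not yet reached. -/
theorem Run.swap_pre {U V : Set S.Proc} {e : Event (aug S)} (hVU : V ⊆ U) (hV : e.proc ∉ V)
    (hs : ∀ d d', WaveInv G U d → CStep d e d' → NoFirstSend V d e) {c₁ c₂ : CConf (aug S)}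
    {l : List (Event (aug S))} (hr : Run (PreStep A V) c₁ l c₂) :
    ∀ c, WaveInv G U c → CStep c e c₁ →
      ∃ d, Run (PreStep A V) c l d ∧ CStep d e c₂ ∧ WaveInv G U d := by
  induction hr with
  | nil => exact fun c hw he => ⟨c, .nil _, he, hw⟩
  | cons h1 _ ih =>
    intro c hw he
    obtain ⟨c', hc', he'⟩ := h1.swap he hV (hs _ _ hw he)
    obtain ⟨d, hd, hd'⟩ := ih c' (hw.preStep hVU hc') he'
    exact ⟨d, .cons hc' hd, hd'⟩

/-- This is where the markers and the FIFO order enter. A base step at a reached processor occurs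
when all its markers have been sent, and the one to the unreached `q` is still in the channel, which
is therefore nonempty. The other steps send no message of the base algorithm. -/
theorem WaveInv.noFirstSend {U V : Set S.Proc} {c : CConf (aug S)} {e : Event (aug S)}
    (hVU : V ⊆ U) (hw : WaveInv G U c) (hq : QGOStep A e.proc e.step)
    (hU : e.proc ∈ U → AugState.ctrl e.step.dst ≠ .idle)
    (hsrc : c.proc e.proc = e.step.src) : NoFirstSend V c e := by
  obtain ⟨p, b⟩ := e
  intro q m hact hq'
  replace hq : QGOStep A p b := hq
  cases hq with
  | base τ b hb =>
    have hp : p ∉ U := fun h => hU h (congrArg AugState.ctrl (liftStep_dst τ b))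
    have hs : Sent U c p q := ⟨hp, by
      rw [show c.proc p = _ from hsrc.trans (liftStep_src τ b)]
      exact trivial⟩
    obtain ⟨l, l', h⟩ := (hw.shape p q).of_inFlight hs (fun h => h.1 (hVU hq'))
    change c.chan (p, q) ≠ []
    rw [h]
    simp
  | _ => cases hact

/-- The events of a global operation may be reordered so that the events at processors not yet
reached by it come first. -/
theorem exists_reorder {W : List (Event (aug S))} : ∀ {U : Set S.Proc} {c c' : CConf (aug S)},
    WaveInv G U c → Run (QGO A).CStep c W c' → (∀ e ∈ W, ∀ q, ¬ IsGlobalInvoke q e) →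
    ∃ (pre post : List (Event (aug S))) (d : CConf (aug S)) (V : Set S.Proc),
      Run (PreStep A U) c pre d ∧ Run (PostStep A) (U, d) post (V, c') ∧
      SameProcs W (pre ++ post) ∧ WaveInv G U d := by
  induction W with
  | nil =>
    intro U c c' hw hr hi
    cases hr
    exact ⟨[], [], c, U, .nil _, .nil _, .refl _, hw⟩
  | cons e W ih =>
    intro U c c' hw hr hi
    cases hr with
    | cons h1 h2 =>
    rename_i c₁
    have hi' : ∀ e ∈ W, ∀ q, ¬ IsGlobalInvoke q e := fun x hx => hi x (List.mem_cons_of_mem _ hx)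
    rcases hw.step h1 (hi e (List.mem_cons_self ..)) with ⟨hpre, hw'⟩ | ⟨hpost, hw'⟩
    · obtain ⟨pre, post, d, V, k1, k2, k3, k4⟩ := ih hw' h2 hi'
      exact ⟨e :: pre, post, d, V, .cons hpre k1, k2, SameProcs.append (.refl [e]) k3, k4⟩
    · obtain ⟨pre, post, d, V, k1, k2, k3, k4⟩ := ih hw' h2 hi'
      have hsub : U \ {e.proc} ⊆ U := fun x hx => hx.1
      have hnot : e.proc ∉ U \ {e.proc} := fun h => h.2 rfl
      -- The events in `pre` occur at processors of `U` other than `e.proc`, so `e` can be moved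
      -- behind all of them.
      obtain ⟨d', j1, j2, j3⟩ := k1.swap_pre hsub hnot (fun d d' hd hd' =>
        hd.noFirstSend hsub hpost.1 hpost.2.2.2.2 hd'.src) c hw h1.2
      refine ⟨pre, e :: post, d', V, j1.mono fun _ _ _ => PreStep.mono hsub,
        .cons ⟨hpost.1, hpost.2.1, j2, rfl, hpost.2.2.2.2⟩ k2, ?_, j3⟩
      exact (SameProcs.append (.refl [e]) k3).trans
        (SameProcs.cons_append (fun x hx h => (k1.proc_mem x hx).2 h) post)

/-- The processor has completed the global operation. -/
def Finished (x : Set S.Proc × CConf (aug S)) (p : S.Proc) : Prop :=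
  p ∉ x.1 ∧ ∃ σ, x.2.proc p = (idleAt σ none : AugState S p)

/-- A processor that is done counts as having received all markers, and by `Shape` a marker in a
channel has not been received. So no marker can draw it into the operation again. -/
theorem Finished.postStep {x y : Set S.Proc × CConf (aug S)} {e : Event (aug S)} {p : S.Proc}
    (hf : Finished x p) (hw : WaveInv G x.1 x.2) (h : PostStep A x e y) : Finished y p := by
  obtain ⟨h1, h2, h3, h4, h5⟩ := h
  obtain ⟨hp, σ, hσ⟩ := hf
  refine ⟨fun h => hp (h4 ▸ h).1, ?_⟩
  have hdst := h3.dst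
  have hsrc := h3.src
  have hch := h3.chan
  obtain ⟨q, b⟩ := e
  by_cases hpq : p = q
  · subst hpq
    replace hsrc : b.src = (idleAt σ none : AugState S p) := hsrc.symm.trans hσ
    change y.2.proc = Function.update x.2.proc p b.dst at hdst
    rw [hdst, Function.update_self]
    replace h1 : QGOStep A p b := h1
    cases h1 with
    | base τ b hb =>
      rw [liftStep_src τ b] at hsrc
      obtain rfl : τ = none := congrArg AugState.tau hsrc
      exact ⟨_, liftStep_dst none b⟩
    | invoke => exact absurd rfl (h2 p)
    | recvFirst σ' G' q =>
      obtain ⟨l, hl, -⟩ := hch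
      have hsh := hw.shape q p
      rw [hl] at hsh
      exact absurd ⟨hp, by rw [hσ]; exact trivial⟩ hsh.marker.2.2.1
    | recvNext => exact absurd (congrArg AugState.tau hsrc) (by simp [LocalStep.src])
    | intercept => exact absurd (congrArg AugState.tau hsrc) (by simp [LocalStep.src])
    | _ => exact absurd (congrArg AugState.ctrl hsrc) (by simp [LocalStep.src, deliverStep])
  · rw [hdst, Function.update_of_ne hpq, hσ]
    exact ⟨σ, rfl⟩

theorem PostStep.finished_of_respond {x y : Set S.Proc × CConf (aug S)} {e : Event (aug S)}
    {p : S.Proc} (h : PostStep A x e y) (he : IsGlobalRespond p e) : Finished y p := by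
  obtain ⟨h1, h2, h3, h4, h5⟩ := h
  have hdst := h3.dst
  obtain ⟨q, b⟩ := e
  replace h1 : QGOStep A q b := h1
  cases h1 with
  | base τ b => cases b <;> exact he.elim
  | respond σ t =>
    obtain rfl : q = p := he
    exact ⟨fun h => (h4 ▸ h).2 rfl, σ, by rw [hdst]; exact Function.update_self ..⟩
  | _ => exact he.elim

theorem Finished.run {x y : Set S.Proc × CConf (aug S)} {l : List (Event (aug S))} {p : S.Proc}
    (hr : Run (PostStep A) x l y) : Finished x p → WaveInv G x.1 x.2 → Finished y p := by
  induction hr with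
  | nil => exact fun h _ => h
  | cons h1 _ ih => exact fun h hw => ih (h.postStep hw h1) (hw.postStep h1)

theorem Run.finished {x y : Set S.Proc × CConf (aug S)} {l : List (Event (aug S))} {p : S.Proc}
    (hr : Run (PostStep A) x l y) :
    WaveInv G x.1 x.2 → (∃ e ∈ l, IsGlobalRespond p e) → Finished y p := by
  induction hr with
  | nil => simp
  | cons h1 h2 ih =>
    rintro hw ⟨e, he, he'⟩
    rcases List.mem_cons.1 he with rfl | he
    · exact (h1.finished_of_respond he').run h2 (hw.postStep h1)
    · exact ih (hw.postStep h1) ⟨e, he, he'⟩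

theorem Run.waveInv {x y : Set S.Proc × CConf (aug S)} {l : List (Event (aug S))}
    (hr : Run (PostStep A) x l y) : WaveInv G x.1 x.2 → WaveInv G y.1 y.2 := by
  induction hr with
  | nil => exact id
  | cons h1 _ ih => exact fun hw => ih (hw.postStep h1)

/-- A classical state of the base system, as a classical state of the system of the QGO algorithm
in which no global operation is underway. -/
def CConf.embed (c : CConf S) : CConf (aug S) where
  proc := fun p => (idleAt (c.proc p) none : AugState S p)
  chan := fun χ => (c.chan χ).map Sum.inl

/-- A finished processor has received the markers from all sources, so none is left in any channel.
-/
theorem exists_embed_of_finished {V : Set S.Proc} {c : CConf (aug S)} (hw : WaveInv G V c)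
    (hf : ∀ p, Finished (V, c) p) : V = ∅ ∧ ∃ d : CConf S, c = d.embed := by
  refine ⟨Set.eq_empty_of_forall_notMem fun p => (hf p).1, ?_⟩
  choose σ hσ using fun p => (hf p).2
  have : ∀ χ : S.Proc × S.Proc, ∃ l : List S.Msg, c.chan χ = l.map Sum.inl := fun χ =>
    (hw.shape χ.1 χ.2).of_got ⟨(hf χ.2).1, by
      rw [show c.proc χ.2 = _ from hσ χ.2]
      exact trivial⟩
  choose l hl using this
  exact ⟨⟨σ, l⟩, CConf.ext' (funext hσ) (funext hl)⟩

theorem waveInv_embed (c : CConf S) : WaveInv G Set.univ c.embed where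
  un := fun _ _ => ⟨_, rfl⟩
  started := fun _ hp => absurd trivial hp
  shape := fun _ _ => .before (fun h => h.1 trivial) (fun h => h.1 trivial) ⟨_, rfl⟩

end Reordering

/-! ## Simulation by the atomic specification -/

section Simulation
variable {S : DistSys.{u}} {A : Algorithm S} {G : GOp S}

/-- The register of the specification at a processor. -/
abbrev Hat (S : DistSys.{u}) : Type u := S.Proc → Option (GOp S × Option (GRes S))

/-- The classical part of `State.applyGlobal`. -/
def CConf.applyGlobal (c : CConf S) (G : GOp S) (rp : S.Proc → S.Out)
    (rm : S.Proc × S.Proc → List S.Out) : CConf S where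
  proc := fun p => (G.proc p (c.proc p)).post (rp p)
  chan := fun χ => G.postChan (c.chan χ) (rm χ)

/-- The classical part of the transitions of the atomic specification. -/
def CSpecStep (A : Algorithm S) (x : CConf S × Hat S) : SpecEvent S → CConf S × Hat S → Prop
  | .base e, y => A.CStep x.1 e y.1 ∧ y.2 = x.2
  | .invoke p G, y => x.2 p = none ∧ y = (x.1, Function.update x.2 p (some (G, none)))
  | .atomic p G rp rm, y => x.2 p = some (G, none) ∧
      (∀ q, rp q ∈ (G.proc q (x.1.proc q)).outcomes) ∧
      (∀ χ, List.Forall₂ (fun m r => r ∈ (G.msg m).outcomes) (x.1.chan χ) (rm χ)) ∧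
      y = (x.1.applyGlobal G rp rm, fun q => some (G, some ⟨rp q, fun q' => rm (q', q)⟩))
  | .respond p R, y => (∃ G, x.2 p = some (G, some R)) ∧ y = (x.1, Function.update x.2 p none)

/-- As in `Algorithm.run_of_crun`, transitions are enabled by classical data alone, and the
operators can be supplied along the run. -/
theorem exists_specRun {ψ : SpecState S} {Z : List (SpecEvent S)} {y : CConf S × Hat S}
    (h : Run (CSpecStep A) (ψ.base.cl, ψ.hat) Z y) : ∃ ψ', Run (SpecStep A) ψ Z ψ' := by
  obtain ⟨ψ', h', -⟩ := h.lift (step' := SpecStep A) (fun ψ => (ψ.base.cl, ψ.hat))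
    (fun a z y hz => by
      obtain ⟨φ, hat⟩ := a
      obtain ⟨d, hat'⟩ := y
      cases z with
      | base e =>
        obtain ⟨⟨h1, h2⟩, rfl⟩ := hz
        obtain ⟨φ', h3, rfl⟩ := h2.exists_validStep
        exact ⟨⟨φ', _⟩, .base ⟨h1, h3⟩, rfl⟩
      | invoke p G =>
        obtain ⟨h1, h2⟩ := hz
        exact ⟨_, .invoke h1, h2.symm⟩
      | atomic p G rp rm =>
        obtain ⟨h1, h2, h3, h4⟩ := hz
        exact ⟨_, .atomic h1 h2 h3, h4.symm⟩
      | respond p R =>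
        obtain ⟨⟨G, h1⟩, h2⟩ := hz
        exact ⟨_, .respond h1, h2.symm⟩) ψ rfl
  exact ⟨ψ', h'⟩

/-- A message on its way to a processor: still to undergo the global operation, or having undergone
it with outcome `r` but not yet passed on, or not taking part in it any more. -/
inductive Item (S : DistSys.{u}) : Type u
  | pend (m : S.Msg)
  | ran (m : S.Msg) (r : S.Out)
  | plain (m : S.Msg)

/-- The messages in a channel whose marker has not been received. -/
def openItems : List (S.Msg ⊕ GOp S) → List (Item S)
  | [] => []
  | .inl m :: l => .pend m :: openItems l
  | .inr _ :: l => (l.filterMap Sum.getLeft?).map .plain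

open Classical in
/-- The messages in a channel, `got` telling whether the marker has been received. -/
def chanItems (got : Prop) (L : List (S.Msg ⊕ GOp S)) : List (Item S) :=
  if got then (L.filterMap Sum.getLeft?).map .plain else openItems L

/-- The message from `a` in hand, if any. -/
def handItems {p : S.Proc} (s : AugState S p) (a : S.Proc) : List (Item S) :=
  match s.hand, s.ctrl with
  | some m, .gotMsg q => if q = a then [.pend m] else []
  | some m, .ranMsg q r => if q = a then [.ran m r] else []
  | _, _ => []

/-- The messages on their way from `a` to `b`, in the hand of `b` or in the channel. -/
def Items (U : Set S.Proc) (c : CConf (aug S)) (a b : S.Proc) : List (Item S) :=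
  handItems (p := b) (c.proc b) a ++ chanItems (Got U c a b) (c.chan (a, b))

/-- The content of a channel of the specification, given the outcomes still to be recorded. -/
inductive Complete (G : GOp S) : List (Item S) → List S.Out → List S.Msg → Prop
  | nil : Complete G [] [] []
  | pend {m : S.Msg} {r : S.Out} {l : List (Item S)} {rs : List S.Out} {L : List S.Msg} :
      r ∈ (G.msg m).outcomes → Complete G l rs L →
      Complete G (.pend m :: l) (r :: rs) ((G.msg m).post r :: L)
  | ran {m : S.Msg} {r : S.Out} {l : List (Item S)} {rs : List S.Out} {L : List S.Msg} :
      Complete G l rs L → Complete G (.ran m r :: l) (r :: rs) (m :: L)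
  | plain {m : S.Msg} {l : List (Item S)} {rs : List S.Out} {L : List S.Msg} :
      Complete G l rs L → Complete G (.plain m :: l) rs (m :: L)

/-- A plain message is the same in both systems and uses no outcome, so it can be taken off the end.
This serves to undo a send. -/
theorem Complete.append_plain {m : S.Msg} {l : List (Item S)} : ∀ {rs : List S.Out}
    {L : List S.Msg}, Complete G (l ++ [.plain m]) rs L → ∃ L', L = L' ++ [m] ∧ Complete G l rs L' := by
  induction l with
  | nil =>
    intro rs L h
    cases h with
    | plain h => cases h; exact ⟨[], rfl, .nil⟩
  | cons x l ih =>
    intro rs L h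
    cases h with
    | pend hr h => obtain ⟨L', rfl, h'⟩ := ih h; exact ⟨_ :: L', rfl, .pend hr h'⟩
    | ran h => obtain ⟨L', rfl, h'⟩ := ih h; exact ⟨_ :: L', rfl, .ran h'⟩
    | plain h => obtain ⟨L', rfl, h'⟩ := ih h; exact ⟨_ :: L', rfl, .plain h'⟩

theorem Complete.of_pend {l : List S.Msg} : ∀ {rs : List S.Out} {L : List S.Msg},
    Complete G (l.map .pend) rs L →
    List.Forall₂ (fun m r => r ∈ (G.msg m).outcomes) l rs ∧ L = G.postChan l rs := by
  induction l with
  | nil => intro rs L h; cases h; exact ⟨.nil, rfl⟩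
  | cons m l ih =>
    intro rs L h
    cases h with
    | pend hr h =>
      obtain ⟨h1, rfl⟩ := ih h
      exact ⟨.cons hr h1, rfl⟩

theorem Complete.of_plain {l : List S.Msg} : ∀ {rs : List S.Out} {L : List S.Msg},
    Complete G (l.map .plain) rs L → rs = [] := by
  induction l with
  | nil => intro rs L h; cases h; rfl
  | cons m l ih =>
    intro rs L h
    cases h with
    | plain h => exact ih h

theorem complete_plain (l : List S.Msg) : Complete G (l.map .plain) [] l := by
  induction l with
  | nil => exact .nil
  | cons m l ih => exact .plain ih

theorem filterMap_getLeft_inl (l : List S.Msg) :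
    (l.map (Sum.inl : S.Msg → S.Msg ⊕ GOp S)).filterMap Sum.getLeft? = l := by
  induction l with
  | nil => rfl
  | cons m l ih => simpa using ih

theorem openItems_inl (l : List S.Msg) :
    openItems (l.map (Sum.inl : S.Msg → S.Msg ⊕ GOp S)) = l.map .pend := by
  induction l with
  | nil => rfl
  | cons m l ih => simp [openItems, ih]

theorem openItems_append_marker {L : List (S.Msg ⊕ GOp S)} (h : NoMark L) (G : GOp S) :
    openItems (L ++ [Sum.inr G]) = openItems L := by
  obtain ⟨l, rfl⟩ := h
  induction l with
  | nil => rfl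
  | cons m l ih => simpa [openItems] using ih

/-- A message sent after the marker lies behind it and takes no part in the operation. -/
theorem openItems_append {L : List (S.Msg ⊕ GOp S)} (h : OneMark G L) (m : S.Msg) :
    openItems (L ++ [Sum.inl m]) = openItems L ++ [.plain m] := by
  obtain ⟨l, l', rfl⟩ := h
  induction l with
  | nil => simp [openItems]
  | cons x l ih => simpa [openItems] using ih

theorem chanItems_append {s g : Prop} {L : List (S.Msg ⊕ GOp S)} (h : Shape G s g L) (hs : s)
    (m : S.Msg) : chanItems g (L ++ [Sum.inl m]) = chanItems g L ++ [.plain m] := by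
  unfold chanItems
  split_ifs with hg
  · simp
  · exact openItems_append (h.of_inFlight hs hg) m

/-- A processor `s` of the QGO algorithm, whose operation on itself has the outcome `r` and with
the outcomes `R` still to be recorded, corresponds to a processor of the specification in state `σ`
with register `h`. -/
inductive ProcSim (G : GOp S) {p : S.Proc} (un : Prop) (s : AugState S p) (r : S.Out)
    (R : S.Proc → List S.Out) (σ : S.CState p) (h : Option (GOp S × Option (GRes S))) : Prop
  | pending : (un ∨ ∃ G' χ, s.ctrl = .exec G' χ) → r ∈ (G.proc p s.base).outcomes →
      σ = (G.proc p s.base).post r → h = some (G, some ⟨r, R⟩) → ProcSim G un s r R σ h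
  | reached : ¬ un → (∀ G' χ, s.ctrl ≠ .exec G' χ) → σ = s.base →
      h = s.tau.map (fun t => (G, some ⟨t.resp.own, fun q => t.resp.chans q ++ R q⟩)) →
      ProcSim G un s r R σ h

/-- A state of the QGO algorithm corresponds to a state of the specification, given the outcomes
`rp` on processors and `rm` on messages that are still to be recorded. -/
structure Sim (G : GOp S) (U : Set S.Proc) (c : CConf (aug S)) (rp : S.Proc → S.Out)
    (rm : S.Proc × S.Proc → List S.Out) (x : CConf S × Hat S) : Prop where
  proc : ∀ p, ProcSim (p := p) G (p ∈ U) (c.proc p) (rp p) (fun q => rm (q, p)) (x.1.proc p) (x.2 p)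
  chan : ∀ a b, Complete G (Items U c a b) (rm (a, b)) (x.1.chan (a, b))

theorem items_update {U U' : Set S.Proc} {c c' : CConf (aug S)} {p : S.Proc} {s' : AugState S p}
    (hU : ∀ x, x ≠ p → (x ∈ U' ↔ x ∈ U)) (hp : c'.proc = Function.update c.proc p s')
    {D : S.Proc → Prop}
    (h : ∀ a, (p ∉ U' ∧ s'.got a) ↔ (p ∉ U ∧ AugState.got (c.proc p) a) ∨ D a) (a b : S.Proc) :
    Items U' c' a b = (if b = p then handItems s' a else handItems (p := b) (c.proc b) a) ++
      chanItems (Got U c a b ∨ (b = p ∧ D a)) (c'.chan (a, b)) := by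
  unfold Items
  rw [propext (got_update hU hp h a b)]
  congr 1
  split_ifs with hb
  · subst hb
    rw [hp, Function.update_self]
  · rw [hp, Function.update_of_ne hb]

/-- Transport backwards in time: the primed data are those after a step at `p`. Away from `p`
nothing changes, so only the condition `h` at `p` is needed. -/
theorem Sim.update_proc {U U' : Set S.Proc} {c c' : CConf (aug S)} {p : S.Proc}
    {s' : AugState S p} {rp rp' : S.Proc → S.Out} {rm rm' : S.Proc × S.Proc → List S.Out}
    {x x' : CConf S × Hat S} (hs : Sim G U' c' rp' rm' x')
    (hU : ∀ x, x ≠ p → (x ∈ U' ↔ x ∈ U)) (hp : c'.proc = Function.update c.proc p s')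
    (hrp : ∀ q, q ≠ p → rp q = rp' q) (hrm : ∀ a b, b ≠ p → rm (a, b) = rm' (a, b))
    (hx : ∀ q, q ≠ p → x.1.proc q = x'.1.proc q) (hat : ∀ q, q ≠ p → x.2 q = x'.2 q)
    (h : ProcSim G (p ∈ U) (c.proc p) (rp p) (fun q => rm (q, p)) (x.1.proc p) (x.2 p)) (q : S.Proc) :
    ProcSim (p := q) G (q ∈ U) (c.proc q) (rp q) (fun a => rm (a, q)) (x.1.proc q) (x.2 q) := by
  by_cases hq : q = p
  · subst hq
    exact h
  · have := hs.proc q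
    rw [hp, Function.update_of_ne hq, propext (hU q hq)] at this
    rw [hrp q hq, hx q hq, hat q hq, show (fun a => rm (a, q)) = fun a => rm' (a, q) from
      funext fun a => hrm a q hq]
    exact this

/-- Classical traits of base events, by which `not_inFilter` recognizes the steps that belong to the
procedures of the QGO algorithm alone. -/
theorem IsBase.cases {e : Event (aug S)} {b : Event S} (h : IsBase e b) :
    (AugState.ctrl e.step.src = .idle ∧ AugState.hand e.step.dst = none ∧
      ∀ q G, e.step.act ≠ .rcv q (.inr G)) ∨ ∃ q r, AugState.ctrl e.step.src = .ranMsg q r := by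
  cases h with
  | lift τ b =>
    left
    refine ⟨congrArg AugState.ctrl (liftStep_src τ b), congrArg AugState.hand (liftStep_dst τ b), ?_⟩
    intro q G
    cases b <;> simp [liftStep, LocalStep.act]
  | deliver t q r => exact .inr ⟨q, r, rfl⟩

/-- The event is not part of the history. -/
theorem not_inFilter {e : Event (aug S)} (hi : ∀ p, ¬ IsGlobalInvoke p e)
    (hr : ∀ p, ¬ IsGlobalRespond p e)
    (h1 : AugState.ctrl e.step.src ≠ .idle ∨ AugState.hand e.step.dst ≠ none ∨
      ∃ q G, e.step.act = .rcv q (.inr G))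
    (h2 : ∀ q r, AugState.ctrl e.step.src ≠ .ranMsg q r) : ¬ InFilter e := by
  rintro (⟨p, h⟩ | ⟨p, h⟩ | ⟨b, h⟩)
  · exact hi p h
  · exact hr p h
  · rcases h.cases with ⟨k1, k2, k3⟩ | ⟨q, r, h⟩
    · rcases h1 with h1 | h1 | ⟨q, G, h1⟩
      · exact h1 k1
      · exact h1 k2
      · exact k3 q G h1
    · exact h2 q r h

/-- A step of the specification corresponding to an event of the QGO algorithm. -/
inductive SimStep (A : Algorithm S) (e : Event (aug S)) (x x' : CConf S × Hat S) : Prop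
  | silent : ¬ InFilter e → x = x' → SimStep A e x x'
  | visible (z : SpecEvent S) : InFilter e → SameAction e z → InSpecFilter z →
      CSpecStep A x z x' → SimStep A e x x'

end Simulation

/-! ### The backward simulation, event by event. -/

section Simulation
variable {S : DistSys.{u}} {A : Algorithm S} {G : GOp S}

section ItemLemmas
variable {U U' : Set S.Proc} {c c' : CConf (aug S)} {p : S.Proc} {s' : AugState S p}

theorem items_update_base (hU : ∀ x, x ≠ p → (x ∈ U' ↔ x ∈ U))
    (hp : c'.proc = Function.update c.proc p s')
    (hg : ∀ a, (p ∉ U' ∧ s'.got a) ↔ (p ∉ U ∧ AugState.got (c.proc p) a))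
    (hh : ∀ a, handItems s' a = handItems (p := p) (c.proc p) a) (a b : S.Proc) :
    Items U' c' a b =
      handItems (p := b) (c.proc b) a ++ chanItems (Got U c a b) (c'.chan (a, b)) := by
  rw [items_update hU hp (D := fun _ => False) (by simpa using hg) a b]
  simp only [and_false, or_false]
  congr 1
  split_ifs with hb
  · subst hb
    exact hh a
  · rfl

theorem items_eq (hU : ∀ x, x ≠ p → (x ∈ U' ↔ x ∈ U))
    (hp : c'.proc = Function.update c.proc p s') (D : S.Proc → Prop)
    (hg : ∀ a, (p ∉ U' ∧ s'.got a) ↔ (p ∉ U ∧ AugState.got (c.proc p) a) ∨ D a)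
    (hh : ∀ a, handItems s' a ++ chanItems (Got U c a p ∨ D a) (c'.chan (a, p)) = Items U c a p)
    (hc : ∀ a b, b ≠ p → chanItems (Got U c a b) (c'.chan (a, b)) =
      chanItems (Got U c a b) (c.chan (a, b))) (a b : S.Proc) :
    Items U' c' a b = Items U c a b := by
  rw [items_update hU hp hg a b]
  by_cases hb : b = p
  · subst hb
    simpa using hh a
  · simp only [hb, if_false, false_and, or_false, Items, hc a b hb]

/-- The reception of a marker. -/
theorem items_eq_of_marker {q : S.Proc} {l : List (S.Msg ⊕ GOp S)}
    (hU : ∀ x, x ≠ p → (x ∈ U' ↔ x ∈ U))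
    (hp : c'.proc = Function.update c.proc p s')
    (hg : ∀ a, (p ∉ U' ∧ s'.got a) ↔ (p ∉ U ∧ AugState.got (c.proc p) a) ∨ a = q)
    (hh : ∀ a, handItems s' a = handItems (p := p) (c.proc p) a)
    (hl : c.chan (q, p) = Sum.inr G :: l) (hch : c'.chan = Function.update c.chan (q, p) l)
    (hq : ¬ Got U c q p) (a b : S.Proc) : Items U' c' a b = Items U c a b := by
  refine items_eq hU hp (fun a => a = q) hg (fun a => ?_) (fun a b hb => ?_) a b
  · unfold Items
    rw [hh, hch]
    congr 1
    by_cases ha : a = q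
    · subst ha
      rw [Function.update_self, hl]
      -- The messages behind the marker are plain in both states: before, because the marker
      -- precedes them, and afterwards, because it counts as received.
      simp [chanItems, hq, openItems]
    · rw [Function.update_of_ne (by simp [ha])]
      simp [ha]
  · rw [hch, Function.update_of_ne (by simp [hb])]

end ItemLemmas

/-- The state `x₁` and the outcomes to come after the event are given, those before it are
constructed. Undoing `execProc` fixes the outcome of the processor, and undoing `deliver` adds an
outcome of a message. Only base events, deliveries and responses correspond to steps of the
specification; the other events leave its state unchanged. -/
theorem Sim.postStep {U U₁ : Set S.Proc} {c c₁ : CConf (aug S)} {e : Event (aug S)}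
    {rp : S.Proc → S.Out} {rm : S.Proc × S.Proc → List S.Out} {x₁ : CConf S × Hat S}
    (hw : WaveInv G U c) (h : PostStep A (U, c) e (U₁, c₁)) (hs : Sim G U₁ c₁ rp rm x₁) :
    ∃ rp' rm' x, Sim G U c rp' rm' x ∧ SimStep A e x x₁ := by
  obtain ⟨p, b⟩ := e
  obtain ⟨hq, hi, hc, hU₁, hpost⟩ := h
  obtain rfl : U₁ = U \ {p} := hU₁
  replace hpost : p ∈ U → AugState.ctrl b.dst ≠ .idle := hpost
  replace hq : QGOStep A p b := hq
  have hnot : p ∉ U \ {p} := fun h => h.2 rfl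
  have hU := diff_singleton_mem_iff U p
  have hsrc : c.proc p = b.src := hc.src
  have hpos := hc.possible
  have hdst : c₁.proc = Function.update c.proc p b.dst := hc.dst
  have hch : ChanStep (T := aug S) p c.chan c₁.chan b.act := hc.chan
  have hloc : p ∉ U → Started (p := p) G b.src := fun h => hsrc ▸ hw.started p h
  have hpU : AugState.ctrl b.src ≠ .idle ∨ AugState.tau b.src ≠ none → p ∉ U := by
    intro hx hU
    obtain ⟨σ, hσ⟩ := hw.un p hU
    rw [← hsrc, hσ] at hx
    simp at hx
  have hps : ProcSim (p := p) G False b.dst (rp p) (fun q => rm (q, p)) (x₁.1.proc p) (x₁.2 p) := by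
    have := hs.proc p
    rwa [hdst, Function.update_self, propext (iff_false_intro hnot)] at this
  have silent : ∀ rp', (∀ q, q ≠ p → rp' q = rp q) →
      (∀ a b, Items (U \ {p}) c₁ a b = Items U c a b) →
      ProcSim (p := p) G (p ∈ U) (c.proc p) (rp' p) (fun q => rm (q, p)) (x₁.1.proc p) (x₁.2 p) →
      Sim G U c rp' rm x₁ := fun rp' h1 h2 h3 =>
    ⟨hs.update_proc hU hdst h1 (fun _ _ _ => rfl) (fun _ _ => rfl) (fun _ _ => rfl) h3,
      fun a b => h2 a b ▸ hs.chan a b⟩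
  have idle_reached : ∀ {σ : S.CState p} {τ : Option (Tau S)}, b.dst = (idleAt σ τ : AugState S p) →
      x₁.1.proc p = σ ∧ x₁.2 p =
        τ.map (fun t => (G, some ⟨t.resp.own, fun q => t.resp.chans q ++ rm (q, p)⟩)) := by
    intro σ τ hb
    rw [hb] at hps
    cases hps with
    | pending h => rcases h with h | ⟨_, _, h⟩ <;> cases h
    | reached _ _ h1 h2 => exact ⟨h1, h2⟩
  cases hq with
  | base τ b hδ hrec =>
    have hp : p ∉ U := fun h => hpost h (congrArg AugState.ctrl (liftStep_dst τ b))
    replace hsrc : c.proc p = idleAt b.src τ := hsrc.trans (liftStep_src τ b)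
    replace hdst : c₁.proc = Function.update c.proc p (idleAt b.dst τ) :=
      hdst.trans (by rw [← liftStep_dst τ b])
    replace hch : ChanStep (T := aug S) p c.chan c₁.chan b.act.lift := liftStep_act τ b ▸ hch
    replace hpos : b.Possible := (liftStep_possible τ b).1 hpos
    obtain ⟨hσ, hhat⟩ := idle_reached (liftStep_dst τ b)
    have hE := items_update_base hU hdst (fun a => by simp [hp, hsrc, AugState.got])
      (fun a => by simp [hsrc, handItems])
    -- The specification takes the same base step; only its channels `ch` before the step depend on
    -- the case.
    have key : ∀ ch : S.Proc × S.Proc → List S.Msg,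
        (∀ x y, Complete G (Items U c x y) (rm (x, y)) (ch (x, y))) →
        ChanStep (T := S) p ch x₁.1.chan b.act →
        ∃ rp' rm' x, Sim G U c rp' rm' x ∧ SimStep A ⟨p, liftStep τ b⟩ x x₁ := by
      intro ch h1 h2
      refine ⟨rp, rm, (⟨Function.update x₁.1.proc p b.src, ch⟩, x₁.2), ⟨hs.update_proc hU hdst
        (fun _ _ => rfl) (fun _ _ _ => rfl) (fun q hq => Function.update_of_ne hq _ _)
        (fun _ _ => rfl) ?_, h1⟩, .visible (.base ⟨p, b⟩) (.inr (.inr ⟨_, .lift τ b⟩))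
          (.base (.lift τ b)) trivial ⟨⟨hδ, ?_⟩, rfl⟩⟩
      · rw [hsrc]
        exact .reached hp (fun _ _ h => by cases h) (Function.update_self ..) hhat
      · refine ⟨Function.update_self .., hpos, ?_, h2⟩
        change x₁.1.proc = Function.update (Function.update _ p _) p b.dst
        rw [Function.update_idem, ← hσ, Function.update_eq_self]
    cases hact : b.act with
    | none =>
      rw [hact] at hch key
      refine key x₁.1.chan (fun x y => ?_) rfl
      have := hs.chan x y
      rwa [hE, show c₁.chan = c.chan from hch] at this
    | snd q m =>
      rw [hact] at hch key
      replace hch : c₁.chan = Function.update c.chan (p, q) (c.chan (p, q) ++ [Sum.inl m]) := hch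
      have hsent : Sent U c p q := ⟨hp, by rw [hsrc]; exact trivial⟩
      -- The marker to `q` was sent earlier, so the new message is plain and can be removed from the
      -- end of the channel of the specification.
      have h1 := hs.chan p q
      rw [hE, hch, Function.update_self, chanItems_append (hw.shape p q) hsent,
        ← List.append_assoc] at h1
      obtain ⟨L, hL, h1⟩ := h1.append_plain
      refine key (Function.update x₁.1.chan (p, q) L) (fun x y => ?_) ?_
      · by_cases hxy : (x, y) = (p, q)
        · obtain ⟨rfl, rfl⟩ := Prod.mk.inj hxy
          rw [Function.update_self]
          exact h1
        · rw [Function.update_of_ne hxy]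
          have := hs.chan x y
          rwa [hE, hch, Function.update_of_ne hxy] at this
      · change x₁.1.chan = _
        rw [Function.update_idem, Function.update_self, ← hL, Function.update_eq_self]
    | rcv q m =>
      rw [hact] at hch key
      obtain ⟨l, hl, hch⟩ := hch
      -- By `NotRecorded` the channel is not waited for, so the received message is plain.
      have hgot : Got U c q p := by
        refine ⟨hp, ?_⟩
        rw [hsrc]
        cases b with
        | recv q' =>
          obtain rfl : q' = q := (Act.rcv.inj hact).1
          cases τ with
          | none => exact trivial
          | some t => exact fun h => hrec ⟨t, rfl, h⟩
        | _ => cases hact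
      refine key (Function.update x₁.1.chan (q, p) (m :: x₁.1.chan (q, p))) (fun x y => ?_)
        ⟨_, Function.update_self .., by simp⟩
      have := hs.chan x y
      by_cases hxy : (x, y) = (q, p)
      · obtain ⟨rfl, rfl⟩ := Prod.mk.inj hxy
        rw [Function.update_self]
        rw [hE, hch, Function.update_self, hsrc] at this
        rw [Items, hl, hsrc]
        simp only [handItems, chanItems, hgot, if_true, List.nil_append] at this ⊢
        exact .plain this
      · rw [Function.update_of_ne hxy]
        rwa [hE, hch, Function.update_of_ne hxy] at this
  | invoke => exact absurd rfl (hi p)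
  | execProc σ τ G' χ r =>
    have hp := hpU (.inl (by simp [LocalStep.src]))
    obtain ⟨rfl, rfl⟩ : G' = G ∧ τ = none := by cases hloc hp; exact ⟨rfl, rfl⟩
    -- Before this event the outcome `r` is still to come, and it is the one that the specification
    -- has to use at `p`.
    refine ⟨Function.update rp p r, rm, x₁, silent _ (fun q hq => Function.update_of_ne hq _ _)
      (fun a b => ?_) ?_, .silent (not_inFilter hi (fun _ => id) (.inl (by simp [LocalStep.src]))
        (by simp [LocalStep.src])) rfl⟩
    · rw [items_update_base hU hdst (fun _ => by
        simp [hp, hsrc, LocalStep.src, LocalStep.dst, liftInstr, AugState.got, newTau, eq_comm])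
        (fun _ => by simp [hsrc, LocalStep.src, LocalStep.dst, liftInstr, handItems])]
      rw [show c₁.chan = c.chan from hch, Items]
    · rw [hsrc, Function.update_self]
      cases hps with
      | pending h => rcases h with h | ⟨_, _, h⟩ <;> cases h
      | reached _ _ h1 h2 => exact .pending (.inr ⟨_, _, rfl⟩) hpos h1 h2
  | sendMarker σ τ G' s q hqs =>
    have hp := hpU (.inl (by simp [LocalStep.src]))
    obtain ⟨rfl, t, rfl, ht⟩ : G' = G ∧ ∃ t, τ = some t ∧ t.op = G := by
      cases hloc hp with | bcast _ t _ h => exact ⟨rfl, t, rfl, h⟩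
    refine ⟨rp, rm, x₁, silent _ (fun _ _ => rfl)
      (fun a b => ?_) ?_, .silent (not_inFilter hi (fun _ => id) (.inl (by simp [LocalStep.src]))
        (by simp [LocalStep.src])) rfl⟩
    · rw [items_update_base hU hdst (fun _ => by
        simp [hp, hsrc, LocalStep.src, LocalStep.dst, AugState.got])
        (fun _ => by simp [hsrc, LocalStep.src, LocalStep.dst, handItems])]
      rw [show c₁.chan = _ from hch, Items]
      by_cases hab : (a, b) = (p, q)
      · obtain ⟨rfl, rfl⟩ := Prod.mk.inj hab
        obtain ⟨h1, h2⟩ := (hw.shape a b).of_not_sent (by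
          simp [Sent, hsrc, LocalStep.src, AugState.sent, hqs])
        rw [Function.update_self]
        simp only [chanItems, h1, if_false]
        rw [openItems_append_marker h2]
      · rw [Function.update_of_ne hab]
    · rw [hsrc]
      cases hps with
      | pending h =>
        rcases h with h | ⟨_, _, h⟩
        · cases h
        · change (if s.erase q = ∅ then Ctrl.idle else Ctrl.bcast G' (s.erase q)) = _ at h
          split_ifs at h
      | reached _ _ h1 h2 => exact .reached hp (fun _ _ h => by cases h) h1 h2
  | recvFirst σ G' q =>
    obtain ⟨l, hl, hch⟩ := hch
    have hsh := hw.shape q p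
    rw [hl] at hsh
    obtain ⟨rfl, h1, h2, h3⟩ := hsh.marker
    have hp : p ∈ U := by
      by_contra hp
      exact h2 ⟨hp, by simp [hsrc, LocalStep.src, AugState.got]⟩
    refine ⟨rp, rm, x₁, silent _ (fun _ _ => rfl) (items_eq_of_marker hU hdst (fun x => ?_)
      (fun _ => ?_) hl hch h2) ?_, .silent (not_inFilter hi (fun _ => id)
        (.inr (.inr ⟨_, _, rfl⟩)) (by simp [LocalStep.src])) rfl⟩
    · simp [hp, LocalStep.dst, AugState.got, eq_comm]
    · simp [hsrc, LocalStep.src, LocalStep.dst, handItems]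
    · rw [hsrc]
      cases hps with
      | pending _ h1 h2 h3 => exact .pending (.inl hp) h1 h2 h3
      | reached _ h => exact absurd rfl (h _ _)
  | recvNext σ t G' q =>
    obtain ⟨l, hl, hch⟩ := hch
    have hp := hpU (.inr (by simp [LocalStep.src]))
    have hsh := hw.shape q p
    rw [hl] at hsh
    obtain ⟨rfl, h1, h2, h3⟩ := hsh.marker
    refine ⟨rp, rm, x₁, silent _ (fun _ _ => rfl) (items_eq_of_marker hU hdst (fun x => ?_)
      (fun _ => ?_) hl hch h2) ?_, .silent (not_inFilter hi (fun _ => id)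
        (.inr (.inr ⟨_, _, rfl⟩)) (by simp [LocalStep.src])) rfl⟩
    · simp [hp, hsrc, LocalStep.src, LocalStep.dst, AugState.got, Tau.close]
      tauto
    · simp [hsrc, LocalStep.src, LocalStep.dst, handItems]
    · rw [hsrc]
      cases hps with
      | pending h =>
        rcases h with h | ⟨_, _, h⟩
        · cases h
        · change (if (t.close q).waitset = ∅ then Ctrl.done else Ctrl.idle) = _ at h
          split_ifs at h
      | reached _ _ h1 h2 => exact .reached hp (fun _ _ h => by cases h) h1 h2
  | respond σ t =>
    have hp := hpU (.inr (by simp [LocalStep.src]))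
    have ht : t.waitset = ∅ := by cases hloc hp with | done _ _ _ h => exact h
    obtain ⟨hσ, hhat⟩ := idle_reached rfl
    have hE : ∀ a b, Items (U \ {p}) c₁ a b = Items U c a b := fun a b => by
      rw [items_update_base hU hdst (fun _ => by
        simp [hp, hsrc, LocalStep.src, LocalStep.dst, AugState.got, ht])
        (fun _ => by simp [hsrc, LocalStep.src, LocalStep.dst, handItems])]
      rw [show c₁.chan = c.chan from hch, Items]
    -- All incoming channels are closed, so only plain items remain and no outcome is missing from
    -- the response.
    have hrm : ∀ q, rm (q, p) = [] := fun q => by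
      have h := hs.chan q p
      have hgot : Got U c q p := ⟨hp, by simp [hsrc, LocalStep.src, AugState.got, ht]⟩
      rw [hE, Items, hsrc] at h
      simp only [LocalStep.src, handItems, List.nil_append, chanItems, hgot, if_true] at h
      exact h.of_plain
    refine ⟨rp, rm, (x₁.1, Function.update x₁.2 p (some (G, some t.resp))), ⟨hs.update_proc hU hdst
        (fun _ _ => rfl) (fun _ _ _ => rfl) (fun _ _ => rfl)
        (fun q hq => Function.update_of_ne hq _ _) ?_, fun a b => hE a b ▸ hs.chan a b⟩,
        .visible (.respond p t.resp) (.inr (.inl ⟨p, rfl⟩)) .respond trivial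
          ⟨⟨G, Function.update_self ..⟩, ?_⟩⟩
    · rw [hsrc]
      refine .reached hp (fun _ _ h => by cases h) hσ ?_
      simp [hrm, LocalStep.src]
    · change x₁ = (x₁.1, Function.update (Function.update x₁.2 p _) p none)
      rw [Function.update_idem, ← show x₁.2 p = none from hhat, Function.update_eq_self]
  | intercept σ t q m hm =>
    obtain ⟨l, hl, hch⟩ := hch
    have hp := hpU (.inr (by simp [LocalStep.src]))
    have hgot : ¬ Got U c q p := fun h => by
      have := h.2
      rw [hsrc] at this
      exact this hm
    refine ⟨rp, rm, x₁, silent _ (fun _ _ => rfl) (items_eq hU hdst (fun _ => False) (fun _ => ?_)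
      (fun a => ?_) fun a b hb => ?_) ?_, .silent (not_inFilter hi (fun _ => id)
        (.inr (.inl (by simp [LocalStep.dst]))) (by simp [LocalStep.src])) rfl⟩
    · simp [hp, hsrc, LocalStep.src, LocalStep.dst, AugState.got]
    -- The message moves from the head of the channel into the hand and is the first pending item
    -- both times.
    · rw [hch, Items, hsrc]
      simp only [or_false]
      by_cases ha : a = q
      · subst ha
        rw [Function.update_self, hl]
        simp [handItems, LocalStep.src, LocalStep.dst, chanItems, hgot, openItems]
      · rw [Function.update_of_ne (by simp [ha])]
        simp [handItems, LocalStep.src, LocalStep.dst, Ne.symm ha]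
    · rw [hch, Function.update_of_ne (by simp [hb])]
    · rw [hsrc]
      cases hps with
      | pending h => rcases h with h | ⟨_, _, h⟩ <;> cases h
      | reached _ _ h1 h2 => exact .reached hp (fun _ _ h => by cases h) h1 h2
  | execMsg σ t q m r =>
    have hp := hpU (.inr (by simp [LocalStep.src]))
    obtain ⟨rfl, hm⟩ : t.op = G ∧ q ∈ t.waitset := by
      cases hloc hp with | gotMsg _ _ _ _ h h' => exact ⟨h, h'⟩
    have hps' : ProcSim (p := p) t.op (p ∈ U) (c.proc p) (rp p) (fun q => rm (q, p))
        (x₁.1.proc p) (x₁.2 p) := by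
      rw [hsrc]
      cases hps with
      | pending h => rcases h with h | ⟨_, _, h⟩ <;> cases h
      | reached _ _ h1 h2 => exact .reached hp (fun _ _ h => by cases h) h1 h2
    refine ⟨rp, rm, x₁, ⟨hs.update_proc hU hdst (fun _ _ => rfl) (fun _ _ _ => rfl)
      (fun _ _ => rfl) (fun _ _ => rfl) hps', fun a b => ?_⟩, .silent (not_inFilter hi
        (fun _ => id) (.inl (by simp [LocalStep.src])) (by simp [LocalStep.src])) rfl⟩
    have h := hs.chan a b
    rw [items_update hU hdst (D := fun _ => False) (fun _ => by
      simp [hp, hsrc, LocalStep.src, LocalStep.dst, AugState.got, handInstr]),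
      show c₁.chan = c.chan from hch] at h
    simp only [and_false, or_false] at h
    split_ifs at h with hb
    · subst hb
      rw [Items, hsrc]
      by_cases ha : q = a
      · subst ha
        simp only [handItems, LocalStep.dst, handInstr, LocalStep.src, if_true,
          List.cons_append, List.nil_append] at h ⊢
        generalize rm (q, b) = rs at h ⊢
        generalize x₁.1.chan (q, b) = L at h ⊢
        -- Backwards, `ran` becomes `pend` with the same outcome `r`; the specification holds the
        -- transformed message in both cases.
        cases h with
        | ran h => exact .pend hpos h
      · simpa [handItems, LocalStep.dst, handInstr, LocalStep.src, ha] using h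
    · exact h
  | deliver t q r σ σ' m e hδ =>
    have hp := hpU (.inr (by simp [LocalStep.src, deliverStep]))
    obtain ⟨hσ, hhat⟩ := idle_reached rfl
    -- Backwards, `r` moves from the end of the record for `q` to the front of the outcomes to come,
    -- and the message, already transformed, returns to the head of the channel.
    refine ⟨rp, Function.update rm (q, p) (r :: rm (q, p)),
      (⟨Function.update x₁.1.proc p σ,
        Function.update x₁.1.chan (q, p) (m :: x₁.1.chan (q, p))⟩, x₁.2),
      ⟨hs.update_proc hU hdst (fun _ _ => rfl)
        (fun a b hb => Function.update_of_ne (by simp [hb]) _ _)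
        (fun x hx => Function.update_of_ne hx _ _) (fun _ _ => rfl) ?_, fun a b => ?_⟩,
      .visible (.base ⟨p, .recv q σ σ' m e⟩) (.inr (.inr ⟨_, .deliver t q r σ σ' m e⟩))
        (.base (.deliver t q r σ σ' m e)) trivial ⟨⟨hδ, ?_⟩, rfl⟩⟩
    · rw [hsrc]
      refine .reached hp (fun _ _ h => by cases h) (Function.update_self ..) (hhat.trans ?_)
      simp only [deliverStep, LocalStep.src, Option.map_some, Tau.append, Option.some.injEq,
        Prod.mk.injEq, GRes.mk.injEq, true_and]
      funext x
      by_cases hx : x = q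
      · subst hx
        simp
      · rw [Function.update_of_ne hx, Function.update_of_ne (by simp [hx])]
    · have h := hs.chan a b
      rw [items_update hU hdst (D := fun _ => False) (fun _ => by
        simp [hp, hsrc, LocalStep.src, LocalStep.dst, AugState.got, deliverStep, Tau.append]),
        show c₁.chan = c.chan from hch] at h
      simp only [and_false, or_false] at h
      split_ifs at h with hb
      · subst hb
        rw [Items, hsrc]
        by_cases ha : q = a
        · subst ha
          simp only [Function.update_self]
          simp only [handItems, LocalStep.dst, deliverStep, LocalStep.src, if_true,
            List.cons_append, List.nil_append] at h ⊢
          exact .ran h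
        · simp only [Function.update_of_ne (show (a, b) ≠ (q, b) by simp [Ne.symm ha])]
          simpa [handItems, LocalStep.dst, deliverStep, LocalStep.src, ha] using h
      · simp only [Function.update_of_ne (show (a, b) ≠ (q, p) by simp [hb])]
        exact h
    · refine ⟨Function.update_self .., trivial, ?_, _, Function.update_self .., by simp⟩
      change x₁.1.proc = Function.update (Function.update _ p _) p σ'
      rw [Function.update_idem, ← hσ, Function.update_eq_self]

end Simulation

/-! ### Matching whole runs with the specification. -/

section Matching
variable {S : DistSys.{u}} {A : Algorithm S} {G : GOp S}

open Classical in
/-- The lists of events have the same history. -/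
def SameHist (l : List (Event (aug S))) (Z : List (SpecEvent S)) : Prop :=
  List.Forall₂ SameAction (l.filter (fun e => InFilter e)) (Z.filter (fun e => InSpecFilter e))

theorem SameHist.nil : SameHist ([] : List (Event (aug S))) [] := List.Forall₂.nil

theorem SameHist.append {l l' : List (Event (aug S))} {Z Z' : List (SpecEvent S)}
    (h : SameHist l Z) (h' : SameHist l' Z') : SameHist (l ++ l') (Z ++ Z') := by
  unfold SameHist
  rw [List.filter_append, List.filter_append]
  exact List.rel_append h h'

theorem SimStep.exists_run {e : Event (aug S)} {x x' : CConf S × Hat S} (h : SimStep A e x x') :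
    ∃ Z, Run (CSpecStep A) x Z x' ∧ SameHist [e] Z := by
  classical
  cases h with
  | silent h1 h2 =>
    subst h2
    exact ⟨[], .nil _, by simp [SameHist, h1]⟩
  | visible z h1 h2 h3 h4 =>
    exact ⟨[z], .cons h4 (.nil _), by simpa [SameHist, h1, h3] using h2⟩

/-- `WaveInv` is carried forwards along the run, `Sim` backwards. -/
theorem Sim.run {y y' : Set S.Proc × CConf (aug S)} {l : List (Event (aug S))}
    {rp : S.Proc → S.Out} {rm : S.Proc × S.Proc → List S.Out} {x' : CConf S × Hat S}
    (hr : Run (PostStep A) y l y') : WaveInv G y.1 y.2 → Sim G y'.1 y'.2 rp rm x' →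
      ∃ rp' rm' x Z, Sim G y.1 y.2 rp' rm' x ∧ Run (CSpecStep A) x Z x' ∧ SameHist l Z := by
  induction hr with
  | nil => exact fun _ hs => ⟨rp, rm, x', [], hs, .nil _, .nil⟩
  | cons h1 _ ih =>
    intro hw hs
    obtain ⟨rp₁, rm₁, x₁, Z₁, k1, k2, k3⟩ := ih (hw.postStep h1) hs
    obtain ⟨rp₂, rm₂, x₂, j1, j2⟩ := k1.postStep hw h1
    obtain ⟨Z₂, j2, j3⟩ := j2.exists_run
    exact ⟨rp₂, rm₂, x₂, Z₂ ++ Z₁, j1, j2.append k2, j3.append k3⟩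

theorem PostStep.cstep {x y : Set S.Proc × CConf (aug S)} {e : Event (aug S)}
    (h : PostStep A x e y) : (QGO A).CStep x.2 e y.2 := ⟨h.1, h.2.2.1⟩

theorem PreStep.exists_base {U : Set S.Proc} {c : CConf S} {c' : CConf (aug S)}
    {e : Event (aug S)} (h : PreStep A U c.embed e c') :
    ∃ b d, A.CStep c b d ∧ c' = d.embed ∧ IsBase e b := by
  obtain ⟨⟨p, b, hp, hb, rfl⟩, hc⟩ := h
  have hsrc : idleAt (c.proc p) none = idleAt b.src none := hc.src.trans (liftStep_src none b)
  have hdst : c'.proc = Function.update c.embed.proc p (idleAt b.dst none : AugState S p) :=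
    hc.dst.trans (by rw [← liftStep_dst none b])
  have hpos : b.Possible := (liftStep_possible none b).1 hc.possible
  have hch : ChanStep (T := aug S) p c.embed.chan c'.chan b.act.lift :=
    liftStep_act none b ▸ hc.chan
  have hproc : c'.proc = fun q => (idleAt (Function.update c.proc p b.dst q) none : AugState S q) := by
    rw [hdst]
    funext q
    by_cases hq : q = p
    · subst hq
      simp
    · rw [Function.update_of_ne hq, Function.update_of_ne hq]
      rfl
  have key : ∀ ch : S.Proc × S.Proc → List S.Msg, ChanStep (T := S) p c.chan ch b.act →
      (c'.chan = fun χ => (ch χ).map Sum.inl) →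
      ∃ b' d, A.CStep c b' d ∧ c' = d.embed ∧ IsBase ⟨p, liftStep none b⟩ b' := fun ch h1 h2 =>
    ⟨⟨p, b⟩, ⟨Function.update c.proc p b.dst, ch⟩,
      ⟨hb, congrArg AugState.base hsrc, hpos, rfl, h1⟩, CConf.ext' hproc h2, .lift none b⟩
  cases hact : b.act with
  | none =>
    rw [hact] at hch key
    exact key c.chan rfl hch
  | snd q m =>
    rw [hact] at hch key
    refine key _ rfl (Eq.trans hch ?_)
    funext χ
    by_cases hχ : χ = (p, q)
    · subst hχ
      simp [CConf.embed]
    · rw [Function.update_of_ne hχ, Function.update_of_ne hχ]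
      rfl
  | rcv q m =>
    rw [hact] at hch key
    obtain ⟨l, hl, hch⟩ := hch
    obtain ⟨m', l', hl', hm, rfl⟩ := List.map_eq_cons_iff.1 (show (c.chan (q, p)).map Sum.inl = _ from hl)
    obtain rfl := Sum.inl.inj hm
    refine key _ ⟨l', hl', rfl⟩ (Eq.trans hch ?_)
    funext χ
    by_cases hχ : χ = (q, p)
    · subst hχ
      simp
    · rw [Function.update_of_ne hχ, Function.update_of_ne hχ]
      rfl

theorem sameHist_base {e : Event (aug S)} {b : Event S} (h : IsBase e b) :
    SameHist [e] [.base b] := by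
  classical
  have h1 : InFilter e := .inr (.inr ⟨b, h⟩)
  have h2 : InSpecFilter (.base b : SpecEvent S) := trivial
  simpa [SameHist, h1, h2] using SameAction.base h

theorem Run.exists_base {U : Set S.Proc} {c₀ c' : CConf (aug S)} {l : List (Event (aug S))}
    (hr : Run (PreStep A U) c₀ l c') : ∀ (c : CConf S) (hat : Hat S), c₀ = c.embed →
      ∃ Z d, Run (CSpecStep A) (c, hat) Z (d, hat) ∧ c' = d.embed ∧ SameHist l Z := by
  induction hr with
  | nil => exact fun c hat h => ⟨[], c, .nil _, h, .nil⟩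
  | cons h1 _ ih =>
    rintro c hat rfl
    obtain ⟨b, d, k1, k2, k3⟩ := h1.exists_base
    obtain ⟨Z, d', j1, j2, j3⟩ := ih d hat k2
    exact ⟨.base b :: Z, d', .cons (ψ' := (d, hat)) ⟨k1, rfl⟩ j1, j2, (sameHist_base k3).append j3⟩

/-- The starting point of the backward simulation. No outcome is still to come, so `r` is arbitrary.
-/
theorem sim_embed (d : CConf S) (r : S.Out) :
    Sim G ∅ d.embed (fun _ => r) (fun _ => []) (d, fun _ => none) where
  proc := fun p => .reached (fun h => h) (fun _ _ h => by cases h) rfl rfl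
  chan := fun a b => by
    have hgot : Got ∅ d.embed a b := ⟨fun h => h, trivial⟩
    have : Items ∅ d.embed a b = (d.chan (a, b)).map .plain := by
      rw [Items, chanItems, if_pos hgot]
      change [] ++ (((d.chan (a, b)).map Sum.inl).filterMap Sum.getLeft?).map Item.plain = _
      rw [filterMap_getLeft_inl, List.nil_append]
    rw [this]
    exact complete_plain _

/-- At the moment of the invocation, the state of the specification results from the application
of the global operation. -/
theorem Sim.eq_applyGlobal {p : S.Proc} {d : CConf S} {d' : CConf (aug S)} {rp : S.Proc → S.Out}
    {rm : S.Proc × S.Proc → List S.Out} {x : CConf S × Hat S}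
    (hp : d'.proc = Function.update d.embed.proc p
      (⟨d.proc p, none, none, .exec G none⟩ : AugState S p))
    (hch : d'.chan = d.embed.chan) (hs : Sim G (Set.univ \ {p}) d' rp rm x) :
    (∀ q, rp q ∈ (G.proc q (d.proc q)).outcomes) ∧
      (∀ χ, List.Forall₂ (fun m r => r ∈ (G.msg m).outcomes) (d.chan χ) (rm χ)) ∧
      x = (d.applyGlobal G rp rm, fun q => some (G, some ⟨rp q, fun q' => rm (q', q)⟩)) := by
  have h1 : ∀ q, rp q ∈ (G.proc q (d.proc q)).outcomes ∧
      x.1.proc q = (G.proc q (d.proc q)).post (rp q) ∧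
      x.2 q = some (G, some ⟨rp q, fun q' => rm (q', q)⟩) := by
    intro q
    have h := hs.proc q
    by_cases hq : q = p
    · subst hq
      rw [hp, Function.update_self] at h
      cases h with
      | pending _ h1 h2 h3 => exact ⟨h1, h2, h3⟩
      | reached _ h => exact absurd rfl (h _ _)
    · rw [hp, Function.update_of_ne hq] at h
      cases h with
      | pending _ h1 h2 h3 => exact ⟨h1, h2, h3⟩
      | reached h => exact absurd ⟨trivial, hq⟩ h
  have h2 : ∀ χ, List.Forall₂ (fun m r => r ∈ (G.msg m).outcomes) (d.chan χ) (rm χ) ∧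
      x.1.chan χ = G.postChan (d.chan χ) (rm χ) := by
    rintro ⟨a, b⟩
    have h := hs.chan a b
    -- No marker counts as received: `p` was reached by the invocation and the other processors are
    -- unreached. Hence all messages in the channels are pending.
    have hgot : ¬ Got (Set.univ \ {p}) d' a b := by
      rintro ⟨h1, h2⟩
      obtain rfl : b = p := by simpa using h1
      rw [hp, Function.update_self] at h2
      cases h2
    have hhand : handItems (p := b) (d'.proc b) a = [] := by
      rw [hp]
      by_cases hb : b = p
      · subst hb
        rw [Function.update_self]
        rfl
      · rw [Function.update_of_ne hb]
        rfl
    rw [Items, hhand, chanItems, if_neg hgot, hch,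
      show d.embed.chan (a, b) = (d.chan (a, b)).map Sum.inl from rfl, openItems_inl] at h
    exact h.of_pend
  exact ⟨fun q => (h1 q).1, fun χ => (h2 χ).1, Prod.ext (CConf.ext' (funext fun q => (h1 q).2.1)
    (funext fun χ => (h2 χ).2)) (funext fun q => (h1 q).2.2)⟩

theorem exists_out_of_respond {p : S.Proc} {e : Event (aug S)} (h : IsGlobalRespond p e) :
    Nonempty S.Out := by
  obtain ⟨q, b⟩ := e
  cases b with
  | respond σ σ' r e =>
    cases r with
    | inl => exact h.elim
    | inr R => exact ⟨R.own⟩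
  | _ => exact h.elim

theorem Run.not_respond {U : Set S.Proc} {c c' : CConf (aug S)} {l : List (Event (aug S))}
    (h : Run (PreStep A U) c l c') : ∀ x ∈ l, ∀ q, ¬ IsGlobalRespond q x := by
  induction h with
  | nil => simp
  | cons h1 _ ih =>
    obtain ⟨⟨p, b, -, -, rfl⟩, -⟩ := h1
    intro x hx q
    rcases List.mem_cons.1 hx with rfl | hx
    · cases b <;> exact id
    · exact ih x hx q

/-- An execution of a single global operation can be reordered so that it matches the
specification. -/
theorem exists_matching_of_wave {c : CConf S} {c₁ c' : CConf (aug S)} {p : S.Proc}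
    {σ : S.CState p} {τ : Option (Tau S)} {e : Event (aug S)} {W : List (Event (aug S))}
    (he : e = ⟨p, .invoke (idleAt σ τ) (⟨σ, none, τ, .exec G none⟩ : AugState S p) (.inr G)
      (Equiv.refl _)⟩)
    (hc : CStep c.embed e c₁) (hr : Run (QGO A).CStep c₁ W c')
    (hW : ∀ x ∈ W, ∀ q, ¬ IsGlobalInvoke q x) (hresp : ∀ q, ∃ x ∈ W, IsGlobalRespond q x) :
    ∃ Y Z d, SameProcs (e :: W) Y ∧ Run (QGO A).CStep c.embed Y c' ∧ c' = d.embed ∧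
      Run (CSpecStep A) (c, fun _ => none) Z (d, fun _ => none) ∧ SameHist Y Z := by
  classical
  -- `sim_embed` needs some outcome, and every response contains one.
  obtain ⟨r⟩ : Nonempty S.Out := let ⟨_, _, h⟩ := hresp p; exists_out_of_respond h
  have hqe : QGOStep A e.proc e.step := by rw [he]; exact .invoke σ τ G
  have hpe : e.proc = p := by rw [he]
  have hact : e.step.act = .none := by rw [he]; rfl
  have hcfg : ∀ {d d' : CConf (aug S)}, CStep d e d' →
      d'.proc = Function.update d.proc p (⟨σ, none, τ, .exec G none⟩ : AugState S p) ∧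
      d'.chan = d.chan ∧ d.proc p = idleAt σ τ := by
    intro d d' h
    subst he
    exact ⟨h.dst, h.chan, h.src⟩
  have hw₁ : WaveInv G (Set.univ \ {p}) c₁ := by
    obtain ⟨h1, h2, h3⟩ := hcfg hc
    obtain rfl : none = τ := congrArg AugState.tau h3
    exact (waveInv_embed c).update_base (diff_singleton_mem_iff _ p) h1
      (fun h => absurd rfl h.2) (fun _ => .exec _ _) (fun _ => by simp [AugState.sent])
      (fun _ => by simp [AugState.got]) (a := .none) h2
  obtain ⟨pre, post, d, V, hpre, hpost, hsame, hwd⟩ := exists_reorder hw₁ hr hW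
  -- The events in `pre` also move before the invocation, which sends nothing and occurs at a
  -- processor different from theirs.
  obtain ⟨d₀, hpre₀, hd₀, -⟩ := hpre.swap_pre (U := Set.univ) (G := G) (e := e)
    (Set.subset_univ _) (fun h => h.2 hpe)
    (fun _ _ _ _ q m h => by rw [hact] at h; cases h) _ (waveInv_embed c) hc
  have hprep : ∀ x ∈ pre, x.proc ≠ e.proc := fun x hx h =>
    (hpre.proc_mem x hx).2 (h.trans hpe)
  have hfin : ∀ q, Finished (V, c') q := by
    intro q
    refine hpost.finished hwd ?_
    obtain ⟨x, hx, hx'⟩ := hresp q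
    rcases List.mem_append.1 ((hsame.mem_iff x).1 hx) with h | h
    · exact absurd hx' (hpre.not_respond x h q)
    · exact ⟨x, h, hx'⟩
  obtain ⟨rfl, d', rfl⟩ := exists_embed_of_finished (hpost.waveInv hwd) hfin
  obtain ⟨rp, rm, x, Zpost, hs, hZpost, hhpost⟩ := Sim.run hpost hwd (sim_embed d' r)
  obtain ⟨Zpre, d₁, hZpre, rfl, hhpre⟩ := hpre₀.exists_base c (fun _ => none) rfl
  obtain ⟨k1, k2, k3⟩ := hcfg hd₀
  obtain rfl : none = τ := congrArg AugState.tau k3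
  obtain rfl : d₁.proc p = σ := congrArg AugState.base k3
  obtain ⟨j1, j2, rfl⟩ := hs.eq_applyGlobal k1 k2
  -- The atomic operation immediately follows its invocation and uses the outcomes found by going
  -- backwards.
  refine ⟨pre ++ ([e] ++ post), Zpre ++ ([.invoke p G, .atomic p G rp rm] ++ Zpost), d', ?_,
    ?_, rfl, ?_, ?_⟩
  · exact (SameProcs.append (.refl [e]) hsame).trans (SameProcs.cons_append hprep post)
  · refine (hpre₀.mono fun _ _ _ => PreStep.cstep).append (.cons ⟨hqe, hd₀⟩ ?_)
    exact hpost.map Prod.snd fun _ _ _ => PostStep.cstep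
  · refine hZpre.append (.cons ⟨rfl, rfl⟩ (.cons ⟨Function.update_self .., j1, j2, rfl⟩ hZpost))
  · refine hhpre.append (SameHist.append ?_ hhpost)
    have h1 : InFilter e := .inl ⟨p, by rw [he]; rfl⟩
    have h2 : InSpecFilter (.invoke p G : SpecEvent S) := trivial
    have h3 : ¬ InSpecFilter (.atomic p G rp rm : SpecEvent S) := fun h => h
    have h4 : SameAction e (.invoke p G) := by rw [he]; exact .invoke
    simpa [SameHist, h1, h2, h3] using h4

/-- With idle processors, empty registers and no markers, only base steps and invocations are
enabled. -/
theorem preStep_of_embed {c : CConf S} {c' : CConf (aug S)} {e : Event (aug S)}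
    (hq : (QGO A).CStep c.embed e c') (hi : ∀ q, ¬ IsGlobalInvoke q e) :
    PreStep A Set.univ c.embed e c' := by
  obtain ⟨p, b⟩ := e
  obtain ⟨hq, hc⟩ := hq
  have hsrc : (idleAt (c.proc p) none : AugState S p) = b.src := hc.src
  have hch := hc.chan
  replace hq : QGOStep A p b := hq
  cases hq with
  | base τ b hb =>
    rw [liftStep_src τ b] at hsrc
    obtain rfl : none = τ := congrArg AugState.tau hsrc
    exact ⟨⟨p, b, trivial, hb, rfl⟩, hc⟩
  | invoke => exact absurd rfl (hi p)
  | recvFirst σ G' q =>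
    obtain ⟨l, hl, -⟩ := hch
    exact absurd ⟨_, hl.symm⟩ not_noMark_cons
  | recvNext => exact absurd (congrArg AugState.tau hsrc) (by simp [LocalStep.src])
  | intercept => exact absurd (congrArg AugState.tau hsrc) (by simp [LocalStep.src])
  | _ => exact absurd (congrArg AugState.ctrl hsrc) (by simp [LocalStep.src, deliverStep])

/-- Before the end and before the next invocation, all processors respond to an invocation. -/
def Answered (es : List (Event (aug S))) : Prop :=
  ∀ a i w b, es = a ++ i :: (w ++ b) → (∃ p, IsGlobalInvoke p i) →
    (b = [] ∨ ∃ j b', b = j :: b' ∧ ∃ p, IsGlobalInvoke p j) →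
    ∀ q, ∃ x ∈ w, IsGlobalRespond q x

theorem Answered.of_append {l l' : List (Event (aug S))} (h : Answered (l ++ l')) : Answered l' := by
  rintro a i w b rfl
  exact h (l ++ a) i w b (by simp)

theorem exists_append_of_first {α : Type u} (P : α → Prop) (l : List α) :
    ∃ w b, l = w ++ b ∧ (∀ x ∈ w, ¬ P x) ∧ (b = [] ∨ ∃ j b', b = j :: b' ∧ P j) := by
  induction l with
  | nil => exact ⟨[], [], rfl, by simp, .inl rfl⟩
  | cons x l ih =>
    by_cases hx : P x
    · exact ⟨[], x :: l, rfl, by simp, .inr ⟨x, l, rfl, hx⟩⟩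
    · obtain ⟨w, b, rfl, h1, h2⟩ := ih
      exact ⟨x :: w, b, rfl, by simpa [hx] using h1, h2⟩

/-- If `w` extends to the end of the run, the responses come from `NoPending`; if it is followed by
an invocation, `NoConcurrent` places them before that one. -/
theorem answered_of_noPending {X : Execution (State (aug S)) (Event (aug S))}
    (hp : NoPending X) (hc : NoConcurrent X) : Answered X.events := by
  obtain ⟨init, events⟩ := X
  rintro a i w b h hi hb q
  replace h : events = a ++ i :: (w ++ b) := h
  subst h
  -- `n` is the position of `i`; the positions after it and below `a.length + 1 + w.length` are
  -- those of `w`.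
  let n : Fin (a ++ i :: (w ++ b)).length := ⟨a.length, by simp⟩
  have hn : (a ++ i :: (w ++ b)).get n = i := by simp [n]
  have key : ∀ k : Fin (a ++ i :: (w ++ b)).length, n < k → k.1 < a.length + 1 + w.length →
      (a ++ i :: (w ++ b)).get k ∈ w := by
    intro k hk hk'
    replace hk : a.length < k.1 := hk
    obtain ⟨m, hm⟩ : ∃ m, k.1 = a.length + (m + 1) := ⟨k.1 - a.length - 1, by omega⟩
    have hm' : m < w.length := by omega
    have : (a ++ i :: (w ++ b)).get k = w[m] := by
      simp [hm, List.getElem_append_right, List.getElem_append_left, hm']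
    rw [this]
    exact List.getElem_mem _
  rcases hb with rfl | ⟨j, b', rfl, hj⟩
  · obtain ⟨k, hk, hk'⟩ := hp n (by rw [← hn] at hi; exact hi) q
    exact ⟨_, key k hk (by have := k.2; simp at this; omega), hk'⟩
  · let n' : Fin (a ++ i :: (w ++ j :: b')).length := ⟨a.length + 1 + w.length, by simp; omega⟩
    have hn' : (a ++ i :: (w ++ j :: b')).get n' = j := by
      have : a.length + 1 + w.length = a.length + (w.length + 1) := by omega
      simp [n', this, List.getElem_append_right]
    obtain ⟨k, hk, hk', hk''⟩ := hc n n' (by change a.length < a.length + 1 + w.length; omega)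
      (by rw [← hn] at hi; exact hi) (by rw [← hn'] at hj; exact hj) q
    exact ⟨_, key k hk hk', hk''⟩

/-- The induction is on a bound for the length, because one step may consume a whole segment: an
invocation with all events up to the next one. By `Answered` the segment ends in an embedded state,
from which the rest is treated. -/
theorem exists_matching (n : ℕ) : ∀ (es : List (Event (aug S))), es.length ≤ n →
    ∀ (c : CConf S) (c' : CConf (aug S)), Run (QGO A).CStep c.embed es c' → Answered es →
    ∃ Y Z x, SameProcs es Y ∧ Run (QGO A).CStep c.embed Y c' ∧
      Run (CSpecStep A) (c, fun _ => none) Z x ∧ SameHist Y Z := by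
  induction n with
  | zero =>
    intro es hn c c' hr _
    obtain rfl : es = [] := List.length_eq_zero_iff.1 (Nat.le_zero.1 hn)
    exact ⟨[], [], _, .refl _, hr, .nil _, .nil⟩
  | succ n ih =>
    intro es hn c c' hr ha
    cases hr with
    | nil => exact ⟨[], [], _, .refl _, .nil _, .nil _, .nil⟩
    | cons h1 h2 =>
    rename_i c₁ e es
    have hn' : es.length ≤ n := by simpa using hn
    by_cases hi : ∃ p, IsGlobalInvoke p e
    · obtain ⟨W, rest, rfl, hW, hrest⟩ := exists_append_of_first
        (fun x : Event (aug S) => ∃ p, IsGlobalInvoke p x) es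
      obtain ⟨c₂, hrW, hrrest⟩ := h2.split
      obtain ⟨p, σ, τ, G, he⟩ : ∃ (p : S.Proc) (σ : S.CState p) (τ : Option (Tau S)) (G : GOp S),
          e = ⟨p, .invoke (idleAt σ τ) (⟨σ, none, τ, .exec G none⟩ : AugState S p) (.inr G)
            (Equiv.refl _)⟩ := by
        obtain ⟨p', hi⟩ := hi
        obtain ⟨p, b⟩ := e
        have hq : QGOStep A p b := h1.1
        cases hq with
        | invoke σ τ G => exact ⟨p, σ, τ, G, rfl⟩
        | base τ b => cases b <;> exact hi.elim
        | _ => exact hi.elim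
      obtain ⟨Y, Z, d, k1, k2, rfl, k4, k5⟩ := exists_matching_of_wave he h1.2 hrW
        (fun x hx q hq => hW x hx ⟨q, hq⟩) (ha [] e W rest rfl hi hrest)
      obtain ⟨Y', Z', x, j1, j2, j3, j4⟩ := ih rest
        (by simp at hn'; omega) d c' hrrest (Answered.of_append (l := e :: W) ha)
      exact ⟨Y ++ Y', Z ++ Z', x, k1.append j1, k2.append j2, k4.append j3, k5.append j4⟩
    · obtain ⟨b, d, k1, rfl, k3⟩ :=
        (preStep_of_embed h1 (fun q hq => hi ⟨q, hq⟩)).exists_base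
      obtain ⟨Y, Z, x, j1, j2, j3, j4⟩ := ih es hn' d c' h2 (Answered.of_append (l := [e]) ha)
      exact ⟨e :: Y, .base b :: Z, x, SameProcs.append (.refl [e]) j1, .cons h1 j2,
        .cons (ψ' := (d, fun _ => none)) ⟨k1, rfl⟩ j3, (sameHist_base k3).append j4⟩

end Matching
end QDist
end

open QDist
theorem theorem2 (S : DistSys.{u}) (A : Algorithm S)
    (X : Execution (State (aug S)) (Event (aug S)))
    (hX : (QGO A).IsExecution X) (hpend : NoPending X) (hconc : NoConcurrent X) :
    ∃ (Y : Execution (State (aug S)) (Event (aug S)))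
      (Z : Execution (SpecState S) (SpecEvent S)),
      (QGO A).IsExecution Y ∧ IsSpecExecution A Z ∧ X.init = Z.init.base.embed ∧
        Equicausal X Y ∧ SameHistory Y Z := by
  obtain ⟨⟨ψ, hψ, hinit⟩, ψ', hrun⟩ := hX
  have hrun' : Run (QGO A).CStep ψ.cl.embed X.events ψ'.cl := by
    have := Algorithm.crun_of_run hrun
    rwa [← hinit] at this
  obtain ⟨Y, Z, x, h1, h2, h3, h4⟩ := exists_matching X.events.length X.events le_rfl ψ.cl ψ'.cl
    hrun' (answered_of_noPending hpend hconc)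
  refine ⟨⟨X.init, Y⟩, ⟨⟨ψ, fun _ => none⟩, Z⟩, ⟨⟨ψ, hψ, hinit⟩, ?_⟩, ⟨hψ, fun _ => rfl,
    exists_specRun h3⟩, hinit.symm, equicausal_of_sameProcs rfl h1, h4⟩
  -- The reordered run was constructed classically; its operators are supplied here.
  exact Algorithm.run_of_crun (c := ψ'.cl) (by rw [← hinit]; exact h2)
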